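/- Fix $\tau\in\mathbb C$ with $\operatorname{Im}\tau>0$, and let $\theta(x)=\theta(x,\tau)$ be the odd theta function normalized by $\theta'(0)=1$, namely $$\theta(x,\tau)=-\frac{e^{-\pi i x}}{2\pi i}\,\frac{(e^{2\pi i x};q)\,(q e^{-2\pi i x};q)}{(q;q)^{2}},\qquad q=e^{2\pi i\tau},\quad (a;q)=\prod_{j\ge 0}(1-aq^j).$$ For $m\ge 1$ and $A,B\in\mathbb C^\times$ let $T_{m,A,B}$ be the space of theta-polynomials of degree $m$ with multipliers $A,B$: the entire functions $f$ with $$f(x+1)=A(-1)^m f(x),\qquad f(x+\tau)=B(-1)^m e^{-\pi i m\tau-2\pi i m x}f(x).$$ Let $P_{m,A}$ be the set of nonzero elements of $\bigcup_{B\in\mathbb C^\times}T_{m,A,B}$ up to multiplication by nonzero constants, and $P_m=\bigcup_{A\in\mathbb C^\times}P_{m,A}$. The elliptic Wronski map is $$\operatorname{Wr}:P_{m,1}\times(P_m\setminus P_{m,1})\to P_{2m}\setminus P_{2m,1},\qquad (f,g)\mapsto fg'-f'g .$$ For $w\in\mathbb C$ let $\Lambda=\{w+a+b\tau: 0\le a,b<1\}$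 and $\Lambda'=\{w+a+b\tau: 0<a,b<1\}$. Every $f\in P_m$ can be written, up to a constant factor, as $e^{2\pi i\ell x}\prod_{j=1}^m\theta(x-u_j)$ with $\ell\in\mathbb C$ and $u_1,\dots,u_m\in\Lambda$, where $\ell$ and the multiset $\{u_1,\dots,u_m\}$ are unique; $\ell=l(f)$ is called the label of $f$ relative to $\Lambda$. For $h\in P_{2m}\setminus P_{2m,1}$ and $k\in\mathbb Z$ put $$\operatorname{Wr}_k^{-1}(h)=\{(f,g)\in P_{m,1}\times(P_m\setminus P_{m,1}) : \operatorname{Wr}(f,g)=h,\ l(f)=k\}.$$ **Theorem.** Let $m\ge 1$, $w\in\mathbb C$, and let $z_1,\dots,z_{2m}\in\Lambda'$ be pairwise distinct. Then there exists $N>0$ such that for every $\mu\in\mathbb C$ with $|\operatorname{Im}\mu|>N$, for the point $h\in P_{2m}\setminus P_{2m,1}$ given by $$h(x)=e^{-2\pi i\mu x}\prod_{a=1}^{2m}\theta(x-z_a),$$ and for every $k\in\mathbb Z$, the set $\operatorname{Wr}_k^{-1}(h)$ consists of exactly $\binom{2m}{m}$ points. Moreover, every $(f,g)\in\operatorname{Wr}_k^{-1}(h)$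 has, up to constant factors, the form $$f(x)=e^{2\pi i k x}\prod_{j=1}^m\theta(x-t_j),\qquad g(x)=e^{-2\pi i(\mu+k)x}\prod_{j=1}^m\theta(x-s_j),$$ where $t_1,\dots,t_m,s_1,\dots,s_m\in\Lambda'$ and all the numbers $t_1,\dots,t_m,s_1,\dots,s_m,z_1,\dots,z_{2m}$ are pairwise distinct. -/

import Mathlib

noncomputable section

namespace EllipticWronski

/-- The infinite product `(a; q) = ∏_{j ≥ 0} (1 - a q^j)`. -/
def qPoch (a q : ℂ) : ℂ := ∏' j : ℕ, (1 - a * q ^ j)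

/-- The odd theta function normalized by `θ'(0, τ) = 1`, with `z = e^{2πix}`, `q = e^{2πiτ}`:
`θ(x, τ) = - (e^{-πix} / 2πi) (z; q) (q/z; q) (q; q)^{-2}`. -/
def theta (τ x : ℂ) : ℂ :=
  -(Complex.exp (-(Real.pi * Complex.I * x)) / (2 * Real.pi * Complex.I))
    * qPoch (Complex.exp (2 * Real.pi * Complex.I * x))
        (Complex.exp (2 * Real.pi * Complex.I * τ))
    * qPoch (Complex.exp (2 * Real.pi * Complex.I * τ) / Complex.exp (2 * Real.pi * Complex.I * x))
        (Complex.exp (2 * Real.pi * Complex.I * τ))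
    / (qPoch (Complex.exp (2 * Real.pi * Complex.I * τ))
        (Complex.exp (2 * Real.pi * Complex.I * τ))) ^ 2

/-- The function `x ↦ e^{2πiμx} ∏_j θ(x - u_j, τ)`. -/
def thetaProd (τ μ : ℂ) {n : ℕ} (u : Fin n → ℂ) : ℂ → ℂ := fun x =>
  Complex.exp (2 * Real.pi * Complex.I * μ * x) * ∏ j, theta τ (x - u j)

/-- The space `T_{m,A,B}` of theta-polynomials of degree `m` with multipliers `A`, `B`: entire
functions with `f(x+1) = A (-1)^m f(x)` and `f(x+τ) = B (-1)^m e^{-πimτ - 2πimx} f(x)`. -/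
def T (τ : ℂ) (m : ℕ) (A B : ℂ) : Submodule ℂ (ℂ → ℂ) where
  carrier := {f | Differentiable ℂ f ∧ (∀ x, f (x + 1) = A * (-1) ^ m * f x) ∧
    ∀ x, f (x + τ) = B * (-1) ^ m *
      Complex.exp (-(Real.pi * Complex.I * m * τ) - 2 * Real.pi * Complex.I * m * x) * f x}
  add_mem' := by
    rintro f g ⟨hf, hf1, hf2⟩ ⟨hg, hg1, hg2⟩
    refine ⟨hf.add hg, fun x => ?_, fun x => ?_⟩
    · simp only [Pi.add_apply, hf1, hg1]; ring
    · simp only [Pi.add_apply, hf2, hg2]; ring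
  zero_mem' := ⟨differentiable_const 0, by simp, by simp⟩
  smul_mem' := by
    rintro c f ⟨hf, hf1, hf2⟩
    refine ⟨hf.const_smul c, fun x => ?_, fun x => ?_⟩
    · simp only [Pi.smul_apply, smul_eq_mul, hf1]; ring
    · simp only [Pi.smul_apply, smul_eq_mul, hf2]; ring

/-- The space `P_{m,A}` of nonzero theta-polynomials of degree `m` with first multiplier `A`, up to
multiplication by nonzero numbers. -/
def PA (τ : ℂ) (m : ℕ) (A : ℂ) : Set (Projectivization ℂ (ℂ → ℂ)) :=
  {p | A ≠ 0 ∧ ∃ B : ℂ, B ≠ 0 ∧ p.submodule ≤ T τ m A B}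

/-- The space `P_m` of nonzero theta-polynomials of degree `m`, up to multiplication by nonzero
numbers. -/
def P (τ : ℂ) (m : ℕ) : Set (Projectivization ℂ (ℂ → ℂ)) := ⋃ A : ℂ, PA τ m A

/-- The point `p` is the class of the function `F`. -/
def IsClassOf (p : Projectivization ℂ (ℂ → ℂ)) (F : ℂ → ℂ) : Prop :=
  p.submodule = Submodule.span ℂ {F}

/-- The Wronskian `Wr(f, g) = f g' - f' g`. -/
def wr (f g : ℂ → ℂ) : ℂ → ℂ := fun x => f x * deriv g x - deriv f x * g x

theorem rep_mem {p : Projectivization ℂ (ℂ → ℂ)} {S : Submodule ℂ (ℂ → ℂ)}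
    (h : p.submodule ≤ S) : p.rep ∈ S := by
  apply h
  rw [Projectivization.submodule_eq]
  exact Submodule.mem_span_singleton_self _

theorem wr_mem {τ : ℂ} {m : ℕ} {A₁ B₁ A₂ B₂ : ℂ} {f g : ℂ → ℂ}
    (hf : f ∈ T τ m A₁ B₁) (hg : g ∈ T τ m A₂ B₂) :
    wr f g ∈ T τ (2 * m) (A₁ * A₂) (B₁ * B₂) := by
  obtain ⟨hf, hf1, hf2⟩ := hf
  obtain ⟨hg, hg1, hg2⟩ := hg
  have hd : ∀ u : ℂ → ℂ, Differentiable ℂ u → Differentiable ℂ (deriv u) := fun u hu =>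
    (hu.contDiff (n := 2)).differentiable_deriv_two
  have key1 : ∀ (u : ℂ → ℂ) (c : ℂ), Differentiable ℂ u → (∀ x, u (x + 1) = c * u x) →
      ∀ x, deriv u (x + 1) = c * deriv u x := by
    intro u c hu h x
    have : deriv (fun y => u (y + 1)) x = deriv (fun y => c * u y) x := by
      congr 1; funext y; exact h y
    rwa [deriv_comp_add_const, deriv_const_mul _ (hu x)] at this
  have key2 : ∀ (u : ℂ → ℂ) (c : ℂ), Differentiable ℂ u →
      (∀ x, u (x + τ) = c *
        Complex.exp (-(Real.pi * Complex.I * m * τ) - 2 * Real.pi * Complex.I * m * x) * u x) →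
      ∀ x, deriv u (x + τ) = c *
        Complex.exp (-(Real.pi * Complex.I * m * τ) - 2 * Real.pi * Complex.I * m * x) *
          (deriv u x - 2 * Real.pi * Complex.I * m * u x) := by
    intro u c hu h x
    have e : deriv (fun y => u (y + τ)) x = deriv (fun y => c *
        Complex.exp (-(Real.pi * Complex.I * m * τ) - 2 * Real.pi * Complex.I * m * y) * u y) x := by
      congr 1; funext y; exact h y
    rw [deriv_comp_add_const] at e
    rw [e]
    have h1 : HasDerivAt (fun y : ℂ =>
        -(Real.pi * Complex.I * m * τ) - 2 * Real.pi * Complex.I * m * y)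
        (-(2 * Real.pi * Complex.I * m)) x := by
      simpa using ((hasDerivAt_id x).const_mul (2 * Real.pi * Complex.I * m : ℂ)).const_sub
        (-(Real.pi * Complex.I * m * τ) : ℂ)
    have h2 := ((h1.cexp.const_mul c).mul (hu x).hasDerivAt).deriv
    refine h2.trans ?_
    ring
  refine ⟨(hf.mul (hd g hg)).sub ((hd f hf).mul hg), fun x => ?_, fun x => ?_⟩
  · simp only [wr, hf1, hg1, key1 f _ hf hf1, key1 g _ hg hg1]
    ring
  · simp only [wr, hf2, hg2, key2 f _ hf hf2, key2 g _ hg hg2]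
    have : Complex.exp (-(Real.pi * Complex.I * ((2 * m : ℕ) : ℂ) * τ)
        - 2 * Real.pi * Complex.I * ((2 * m : ℕ) : ℂ) * x) =
        Complex.exp (-(Real.pi * Complex.I * m * τ) - 2 * Real.pi * Complex.I * m * x) ^ 2 := by
      rw [← Complex.exp_nat_mul]
      congr 1
      push_cast
      ring
    rw [this]
    ring

theorem wr_ne_zero {τ : ℂ} {m : ℕ} {A₁ B₁ A₂ B₂ : ℂ} {f g : ℂ → ℂ}
    (hf : f ∈ T τ m A₁ B₁) (hg : g ∈ T τ m A₂ B₂) (hf0 : f ≠ 0) (hg0 : g ≠ 0) (hA : A₁ ≠ A₂) :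
    wr f g ≠ 0 := by
  intro h0
  obtain ⟨hf, hf1, -⟩ := hf
  obtain ⟨hg, hg1, -⟩ := hg
  obtain ⟨a, ha⟩ := Function.ne_iff.mp hf0
  -- near `a` the quotient `g / f` is constant
  have hne : ∀ᶠ x in nhds a, f x ≠ 0 := (hf.continuous.continuousAt).eventually_ne ha
  obtain ⟨r, hr, hball⟩ := Metric.eventually_nhds_iff_ball.mp hne
  have hder : ∀ x ∈ Metric.ball a r, HasDerivAt (fun y => g y / f y) 0 x := by
    intro x hx
    have h1 := (hg x).hasDerivAt.div (hf x).hasDerivAt (hball x hx)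
    have h2 : deriv g x * f x - g x * deriv f x = 0 := by
      have := congrFun h0 x
      simp only [wr, Pi.zero_apply] at this
      linear_combination this
    rw [h2, zero_div] at h1
    exact h1
  have hconst : ∀ x ∈ Metric.ball a r, g x / f x = g a / f a := by
    intro x hx
    refine Metric.isOpen_ball.is_const_of_deriv_eq_zero
      (convex_ball a r).isPreconnected
      (fun y hy => (hder y hy).differentiableAt.differentiableWithinAt)
      (fun y hy => (hder y hy).deriv) hx (Metric.mem_ball_self hr)
  have heq : g = fun x => g a / f a * f x := by
    have hev : g =ᶠ[nhds a] fun x => g a / f a * f x := by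
      filter_upwards [Metric.ball_mem_nhds a hr] with x hx
      rw [← hconst x hx, div_mul_cancel₀ _ (hball x hx)]
    exact AnalyticOnNhd.eq_of_eventuallyEq (hg.differentiableOn.analyticOnNhd isOpen_univ)
      ((hf.const_mul _).differentiableOn.analyticOnNhd isOpen_univ) hev
  obtain ⟨b, hb⟩ := Function.ne_iff.mp hg0
  have e1 := hg1 b
  have e2 : g (b + 1) = A₁ * (-1) ^ m * g b := by
    rw [congrFun heq (b + 1), congrFun heq b, hf1]
    ring
  rw [e2] at e1
  have hs : ((-1 : ℂ) ^ m) ≠ 0 := pow_ne_zero _ (by norm_num)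
  exact hA (mul_right_cancel₀ hs (mul_right_cancel₀ hb e1))

theorem multiplier_unique {τ : ℂ} {m : ℕ} {A₁ B₁ A₂ B₂ : ℂ} {f : ℂ → ℂ}
    (h₁ : f ∈ T τ m A₁ B₁) (h₂ : f ∈ T τ m A₂ B₂) (h0 : f ≠ 0) : A₁ = A₂ := by
  obtain ⟨b, hb⟩ := Function.ne_iff.mp h0
  have hs : ((-1 : ℂ) ^ m) ≠ 0 := pow_ne_zero _ (by norm_num)
  exact mul_right_cancel₀ hs (mul_right_cancel₀ hb ((h₁.2.1 b).symm.trans (h₂.2.1 b)))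

theorem wr_rep_ne_zero {τ : ℂ} {m : ℕ} {p₁ p₂ : Projectivization ℂ (ℂ → ℂ)}
    (h₁ : p₁ ∈ PA τ m 1) (h₂ : p₂ ∈ P τ m \ PA τ m 1) : wr p₁.rep p₂.rep ≠ 0 := by
  obtain ⟨-, B₁, -, hT₁⟩ := h₁
  obtain ⟨hP, hn⟩ := h₂
  obtain ⟨A₂, hA₂⟩ := Set.mem_iUnion.mp hP
  have hA : (1 : ℂ) ≠ A₂ := by
    rintro rfl
    exact hn hA₂
  obtain ⟨-, B₂, -, hT₂⟩ := hA₂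
  exact wr_ne_zero (rep_mem hT₁) (rep_mem hT₂) p₁.rep_nonzero p₂.rep_nonzero hA

theorem wr_rep_mem {τ : ℂ} {m : ℕ} {p₁ p₂ : Projectivization ℂ (ℂ → ℂ)}
    (h₁ : p₁ ∈ PA τ m 1) (h₂ : p₂ ∈ P τ m \ PA τ m 1) :
    Projectivization.mk ℂ (wr p₁.rep p₂.rep) (wr_rep_ne_zero h₁ h₂) ∈
      P τ (2 * m) \ PA τ (2 * m) 1 := by
  have hne := wr_rep_ne_zero h₁ h₂
  obtain ⟨-, B₁, hB₁, hT₁⟩ := h₁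
  obtain ⟨hP, hn⟩ := h₂
  obtain ⟨A₂, hA₂⟩ := Set.mem_iUnion.mp hP
  have hA : (1 : ℂ) ≠ A₂ := by
    rintro rfl
    exact hn hA₂
  obtain ⟨hA0, B₂, hB₂, hT₂⟩ := hA₂
  have hw := wr_mem (rep_mem hT₁) (rep_mem hT₂)
  refine ⟨Set.mem_iUnion.mpr ⟨1 * A₂, by simpa using hA0, B₁ * B₂, mul_ne_zero hB₁ hB₂, ?_⟩, ?_⟩
  · rw [Projectivization.submodule_mk, Submodule.span_singleton_le_iff_mem]
    exact hw
  · rintro ⟨-, B, -, hB⟩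
    rw [Projectivization.submodule_mk, Submodule.span_singleton_le_iff_mem] at hB
    have := multiplier_unique hB hw hne
    exact hA (by simpa using this)

/-- The elliptic Wronski map `P_{m,1} × (P_m - P_{m,1}) → P_{2m} - P_{2m,1}`,
`(f, g) ↦ Wr(f, g)`. -/
def wronskiMap (τ : ℂ) (m : ℕ) (p : PA τ m 1 × ↥(P τ m \ PA τ m 1)) :
    ↥(P τ (2 * m) \ PA τ (2 * m) 1) :=
  ⟨Projectivization.mk ℂ (wr p.1.1.rep p.2.1.rep) (wr_rep_ne_zero p.1.2 p.2.2),
    wr_rep_mem p.1.2 p.2.2⟩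

/-- The Wronski map does not depend on the choice of representatives. -/
theorem wronskiMap_isClassOf (τ : ℂ) (m : ℕ) (p : PA τ m 1 × ↥(P τ m \ PA τ m 1))
    {f g : ℂ → ℂ} (hf : IsClassOf p.1.1 f) (hg : IsClassOf p.2.1 g) :
    IsClassOf (wronskiMap τ m p).1 (wr f g) := by
  have aux : ∀ (q : Projectivization ℂ (ℂ → ℂ)) (F : ℂ → ℂ), IsClassOf q F →
      ∃ c : ℂ, c ≠ 0 ∧ F = c • q.rep := by
    intro q F hF
    have h1 : F ∈ q.submodule := by
      rw [hF]; exact Submodule.mem_span_singleton_self _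
    rw [Projectivization.submodule_eq] at h1
    obtain ⟨c, rfl⟩ := Submodule.mem_span_singleton.mp h1
    refine ⟨c, ?_, rfl⟩
    rintro rfl
    have h2 : q.rep ∈ Submodule.span ℂ {(0 : ℂ) • q.rep} := by
      rw [← hF, Projectivization.submodule_eq]
      exact Submodule.mem_span_singleton_self _
    simp only [zero_smul, Submodule.span_zero_singleton, Submodule.mem_bot] at h2
    exact q.rep_nonzero h2
  obtain ⟨c, hc, rfl⟩ := aux _ _ hf
  obtain ⟨d, hd, rfl⟩ := aux _ _ hg
  have : wr (c • p.1.1.rep) (d • p.2.1.rep) = (c * d) • wr p.1.1.rep p.2.1.rep := by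
    funext x
    simp only [wr, Pi.smul_apply, smul_eq_mul, deriv_const_smul_field]
    ring
  rw [this]
  unfold IsClassOf wronskiMap
  rw [Projectivization.submodule_mk,
    Submodule.span_singleton_smul_eq (IsUnit.mk0 _ (mul_ne_zero hc hd))]

/-- The fundamental parallelogram `Λ_w` with vertices `w, w+1, w+τ, w+1+τ`, containing the sides
`[w, w+1)` and `[w, w+τ)`. -/
def parallelogram (τ w : ℂ) : Set ℂ :=
  {x | ∃ a b : ℝ, a ∈ Set.Ico (0 : ℝ) 1 ∧ b ∈ Set.Ico (0 : ℝ) 1 ∧ x = w + a + b * τ}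

/-- The open parallelogram with the same vertices, that is, the closure of `Λ_w` without its
boundary. -/
def openParallelogram (τ w : ℂ) : Set ℂ :=
  {x | ∃ a b : ℝ, a ∈ Set.Ioo (0 : ℝ) 1 ∧ b ∈ Set.Ioo (0 : ℝ) 1 ∧ x = w + a + b * τ}

/-- `μ` is the label of `p ∈ P_n` relative to `Λ_w`: the point `p` is the class of a function
`e^{2πiμx} ∏_{j=1}^n θ(x - u_j, τ)` with all `u_j` in `Λ_w`. -/
def HasLabel (τ w : ℂ) (n : ℕ) (p : Projectivization ℂ (ℂ → ℂ)) (μ : ℂ) : Prop :=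
  ∃ u : Fin n → ℂ, (∀ j, u j ∈ parallelogram τ w) ∧ IsClassOf p (thetaProd τ μ u)

/-- The labeled preimage `Wr_k⁻¹(h)`: the points `(f, g)` with `Wr(f, g) = h` such that `f` has
label `k` relative to `Λ_w`. -/
def labeledPreimage (τ w : ℂ) (m : ℕ) (h : ↥(P τ (2 * m) \ PA τ (2 * m) 1)) (k : ℤ) :
    Set (PA τ m 1 × ↥(P τ m \ PA τ m 1)) :=
  {p | wronskiMap τ m p = h ∧ HasLabel τ w m p.1.1 k}

end EllipticWronski

end

noncomputable section

namespace EllipticWronski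

open Complex Filter Topology

/-! ### The infinite product (a; q). -/

section qPoch

/-! Large |Im μ| turns the Wronski equation into a small perturbation of a product equation that is
solved by inspection. Number the zeros of f and g together as u_a, with those of f indexed by an
m-subset s of the 2m indices, and let k and ν be the exponents of f and g. By `wr_expThetaFinset`,
Wr(f, g) is, up to a constant and an exponential, the function ∏ θ(x - u_a) - ε ∑_b ±θ'(x - u_b)
∏_{d ≠ b} θ(x - u_d), with ε = -1/(2πi(ν - k)) and the sign -1 exactly on s.

At ε = 0, vanishing at every z_a forces u to be a permutation of z. The derivative in u at (0, z) is
diagonal and invertible, so the implicit function theorem gives, for each s and each small ε,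
exactly one solution u near z (`exists_unique_perturbed_zero`). Compactness shows that every
solution in the closed parallelogram is near some permutation of z
(`exists_perm_of_perturbed_zero`), and relabelling absorbs the permutation. The fibre is thus in
bijection with the m-subsets s.

Two facts connect zeros with functions. A theta-polynomial of degree n vanishing at n points
inequivalent modulo the lattice is determined up to an exponential factor
(`exists_eq_expThetaFinset`). That exponent is then fixed by the multipliers, because the sum of the
u_a is close to the sum of the z_a (`exponent_unique`). Only ν - k enters ε, and its imaginary part
is ±Im μ, so one bound N serves all labels k. -/

theorem summable_norm_mul_pow (a : ℂ) {q : ℂ} (hq : ‖q‖ < 1) :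
    Summable fun j : ℕ => ‖-(a * q ^ j)‖ := by
  simpa using (summable_geometric_of_lt_one (norm_nonneg q) hq).mul_left ‖a‖

theorem qPoch_eq_one_sub_mul (a : ℂ) {q : ℂ} (hq : ‖q‖ < 1) :
    qPoch a q = (1 - a) * qPoch (a * q) q := by
  have h : Multipliable fun j : ℕ => 1 - a * q ^ (j + 1) := by
    have h1 : Multipliable fun j : ℕ => 1 + -(a * q * q ^ j) :=
      multipliable_one_add_of_summable (summable_norm_mul_pow (a * q) hq)
    have h2 : (fun j : ℕ => 1 + -(a * q * q ^ j)) = fun j : ℕ => 1 - a * q ^ (j + 1) := by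
      funext j
      ring
    rwa [h2] at h1
  unfold qPoch
  rw [tprod_eq_zero_mul' (f := fun j : ℕ => 1 - a * q ^ j) h, pow_zero, mul_one]
  simp only [pow_succ', mul_assoc]

theorem qPoch_ne_zero {a q : ℂ} (hq : ‖q‖ < 1) (h : ∀ j : ℕ, a * q ^ j ≠ 1) : qPoch a q ≠ 0 := by
  have := tprod_one_add_ne_zero_of_summable (f := fun j : ℕ => -(a * q ^ j))
    (fun j => by rw [← sub_eq_add_neg, sub_ne_zero]; exact (h j).symm)
    (summable_norm_mul_pow a hq)
  simpa [qPoch, ← sub_eq_add_neg] using this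

theorem differentiable_qPoch {q : ℂ} (hq : ‖q‖ < 1) : Differentiable ℂ fun a => qPoch a q := by
  have h : HasProdLocallyUniformlyOn (fun (j : ℕ) (a : ℂ) => 1 + -(a * q ^ j))
      (fun a => ∏' j : ℕ, (1 + -(a * q ^ j))) Set.univ := by
    apply hasProdLocallyUniformlyOn_of_forall_compact isOpen_univ
    intro K _ hK
    obtain ⟨C, hC⟩ := hK.isBounded.exists_norm_le
    refine ((summable_geometric_of_lt_one (norm_nonneg q) hq).mul_left C).hasProdUniformlyOn_nat_one_add
      hK (.of_forall fun n x hx => ?_) (fun _ => by fun_prop)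
    rw [norm_neg, norm_mul, norm_pow]
    exact mul_le_mul_of_nonneg_right (hC x hx) (by positivity)
  have := h.differentiableOn
    (.of_forall fun _ => by simpa [Finset.prod_fn] using
      DifferentiableOn.finsetProd (fun _ _ => by fun_prop)) isOpen_univ
  rw [differentiableOn_univ] at this
  simpa [qPoch, sub_eq_add_neg] using this

end qPoch

/-! ### Quasi-periodicity and simple zeros of theta. -/

section theta

variable {τ : ℂ}

theorem norm_exp_two_pi_I_mul_lt_one (hτ : 0 < τ.im) : ‖exp (2 * Real.pi * I * τ)‖ < 1 := by
  rw [Complex.norm_exp, Real.exp_lt_one_iff]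
  have : (2 * Real.pi * I * τ).re = -(2 * Real.pi * τ.im) := by simp
  rw [this]
  have := Real.pi_pos
  nlinarith [mul_pos this hτ]

theorem differentiable_theta (hτ : 0 < τ.im) : Differentiable ℂ (theta τ) := by
  have hq := norm_exp_two_pi_I_mul_lt_one hτ
  have h1 : Differentiable ℂ fun x : ℂ => qPoch (exp (2 * Real.pi * I * x))
      (exp (2 * Real.pi * I * τ)) :=
    (differentiable_qPoch hq).comp (by fun_prop)
  have h2 : Differentiable ℂ fun x : ℂ => qPoch (exp (2 * Real.pi * I * τ) /
      exp (2 * Real.pi * I * x)) (exp (2 * Real.pi * I * τ)) :=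
    (differentiable_qPoch hq).comp
      ((differentiable_const _).div (by fun_prop) fun x => exp_ne_zero _)
  unfold theta
  fun_prop

theorem theta_add_one (x : ℂ) : theta τ (x + 1) = -theta τ x := by
  unfold theta
  have h1 : exp (2 * Real.pi * I * (x + 1)) = exp (2 * Real.pi * I * x) := by
    rw [mul_add, mul_one, exp_add, exp_two_pi_mul_I, mul_one]
  have h2 : exp (-(Real.pi * I * (x + 1))) = -exp (-(Real.pi * I * x)) := by
    rw [mul_add, mul_one, neg_add, exp_add, exp_neg (Real.pi * I), exp_pi_mul_I]
    norm_num
  rw [h1, h2]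
  ring

theorem theta_add_tau (hτ : 0 < τ.im) (x : ℂ) :
    theta τ (x + τ) = -exp (-(Real.pi * I * τ) - 2 * Real.pi * I * x) * theta τ x := by
  have hq := norm_exp_two_pi_I_mul_lt_one hτ
  unfold theta
  set q := exp (2 * Real.pi * I * τ) with hqd
  set v := exp (2 * Real.pi * I * x) with hvd
  have hq0 : q ≠ 0 := exp_ne_zero _
  have hv0 : v ≠ 0 := exp_ne_zero _
  have e1 : exp (2 * Real.pi * I * (x + τ)) = v * q := by rw [mul_add, exp_add]
  have e2 : exp (-(Real.pi * I * (x + τ))) = exp (-(Real.pi * I * x)) * exp (-(Real.pi * I * τ)) := by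
    rw [mul_add, neg_add, exp_add]
  have e3 : exp (-(Real.pi * I * τ) - 2 * Real.pi * I * x) = exp (-(Real.pi * I * τ)) * v⁻¹ := by
    rw [exp_sub, div_eq_mul_inv]
  have e4 : q / (v * q) = v⁻¹ := by field_simp
  -- The shift by τ replaces v by vq: one product loses the factor 1 - v and the other gains 1 - v⁻¹
  -- = -v⁻¹(1 - v), which yields the multiplier.
  rw [e1, e2, e3, e4, qPoch_eq_one_sub_mul v⁻¹ hq, qPoch_eq_one_sub_mul v hq]
  have e5 : v⁻¹ * q = q / v := by field_simp
  have e6 : 1 - v⁻¹ = -(v⁻¹) * (1 - v) := by field_simp; ring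
  rw [e5, e6]
  ring

theorem theta_zero (hτ : 0 < τ.im) : theta τ 0 = 0 := by
  have hq := norm_exp_two_pi_I_mul_lt_one hτ
  unfold theta
  rw [mul_zero (2 * Real.pi * I), exp_zero, qPoch_eq_one_sub_mul 1 hq]
  simp

theorem exists_lattice_of_theta_eq_zero (hτ : 0 < τ.im) {x : ℂ} (hx : theta τ x = 0) :
    ∃ a b : ℤ, x = a + b * τ := by
  have hq := norm_exp_two_pi_I_mul_lt_one hτ
  have hpi : (2 * Real.pi * I : ℂ) ≠ 0 := two_pi_I_ne_zero
  have key : ∀ b : ℤ, exp (2 * Real.pi * I * x) = exp (2 * Real.pi * I * (b * τ)) →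
      ∃ a b : ℤ, x = a + b * τ := by
    intro b hb
    obtain ⟨n, hn⟩ := exp_eq_exp_iff_exists_int.mp hb
    refine ⟨n, b, ?_⟩
    apply mul_left_cancel₀ hpi
    rw [hn]; ring
  have hqq : qPoch (exp (2 * Real.pi * I * τ)) (exp (2 * Real.pi * I * τ)) ≠ 0 := by
    apply qPoch_ne_zero hq
    intro j hj
    have h1 : ‖exp (2 * Real.pi * I * τ)‖ ^ (j + 1) = 1 := by
      rw [← norm_pow, pow_succ', hj, norm_one]
    exact absurd h1 (pow_lt_one₀ (norm_nonneg _) hq (by simp)).ne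
  unfold theta at hx
  rw [div_eq_zero_iff, mul_eq_zero, mul_eq_zero] at hx
  rcases hx with ((h | h) | h) | h
  · exact absurd h (neg_ne_zero.mpr (div_ne_zero (exp_ne_zero _) hpi))
  · by_contra hc
    refine qPoch_ne_zero hq (fun j hj => hc (key (-j) ?_)) h
    rw [← exp_nat_mul, ← exp_add] at hj
    rw [eq_comm, ← div_eq_one_iff_eq (exp_ne_zero _), ← exp_sub, ← exp_zero, ← neg_zero, exp_neg,
      exp_zero, ← hj, ← exp_neg]
    congr 1; push_cast; ring
  · by_contra hc
    refine qPoch_ne_zero hq (fun j hj => hc (key (j + 1) ?_)) h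
    rw [← exp_nat_mul, ← exp_sub, ← exp_add] at hj
    rw [eq_comm, ← div_eq_one_iff_eq (exp_ne_zero _), ← exp_sub, ← hj]
    congr 1; push_cast; ring
  · exact absurd h (pow_ne_zero _ hqq)

/-- The factor 1 - e^{2πix} has a simple zero at 0 and the remaining cofactor `R` does not vanish
there. Nonvanishing is all that is used later; the exact value 1 plays no role. -/
theorem deriv_theta_zero_ne_zero (hτ : 0 < τ.im) : deriv (theta τ) 0 ≠ 0 := by
  have hq := norm_exp_two_pi_I_mul_lt_one hτ
  have hpi : (2 * Real.pi * I : ℂ) ≠ 0 := two_pi_I_ne_zero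
  set q := exp (2 * Real.pi * I * τ) with hqd
  have hqq : qPoch q q ≠ 0 := by
    apply qPoch_ne_zero hq
    intro j hj
    have h1 : ‖q‖ ^ (j + 1) = 1 := by
      rw [← norm_pow, pow_succ', hj, norm_one]
    exact absurd h1 (pow_lt_one₀ (norm_nonneg _) hq (by simp)).ne
  set R : ℂ → ℂ := fun x => -(exp (-(Real.pi * I * x)) / (2 * Real.pi * I)) *
    qPoch (exp (2 * Real.pi * I * x) * q) q * qPoch (q / exp (2 * Real.pi * I * x)) q /
      qPoch q q ^ 2 with hR
  have hRd : DifferentiableAt ℂ R 0 := by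
    have h1 : Differentiable ℂ fun x : ℂ => qPoch (exp (2 * Real.pi * I * x) * q) q :=
      (differentiable_qPoch hq).comp (by fun_prop)
    have h2 : Differentiable ℂ fun x : ℂ => qPoch (q / exp (2 * Real.pi * I * x)) q :=
      (differentiable_qPoch hq).comp
        ((differentiable_const _).div (by fun_prop) fun x => exp_ne_zero _)
    have h3 : Differentiable ℂ R := by unfold R; fun_prop
    exact h3 0
  have hfac : theta τ = fun x => (1 - exp (2 * Real.pi * I * x)) * R x := by
    funext x
    simp only [theta, hR, ← hqd]
    rw [qPoch_eq_one_sub_mul (exp (2 * Real.pi * I * x)) hq]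
    ring
  have hE : HasDerivAt (fun x : ℂ => 1 - exp (2 * Real.pi * I * x)) (-(2 * Real.pi * I)) 0 := by
    have := (((hasDerivAt_id (0 : ℂ)).const_mul (2 * Real.pi * I)).cexp).const_sub 1
    simpa using this
  have hd := hE.mul hRd.hasDerivAt
  rw [hfac]
  have := hd.deriv
  simp only [mul_zero, exp_zero, sub_self, zero_mul, add_zero] at this
  change deriv ((fun x : ℂ => 1 - exp (2 * Real.pi * I * x)) * R) 0 ≠ 0
  rw [this]
  refine mul_ne_zero (neg_ne_zero.mpr hpi) ?_
  simp only [hR, mul_zero, exp_zero, neg_zero, one_mul, div_one]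
  refine div_ne_zero (mul_ne_zero (mul_ne_zero ?_ hqq) hqq) (pow_ne_zero _ hqq)
  exact neg_ne_zero.mpr (one_div_ne_zero hpi)

/-- Only the fact that the automorphy factor is entire and zero-free matters: it carries the simple
zero at 0 to every lattice point. -/
theorem theta_add_int_add_int_mul (hτ : 0 < τ.im) (a b : ℤ) :
    ∃ E : ℂ → ℂ, Differentiable ℂ E ∧ (∀ x, E x ≠ 0) ∧
      ∀ x, theta τ (x + a + b * τ) = E x * theta τ x := by
  have h1 : ∀ a : ℤ, ∃ c : ℂ, c ≠ 0 ∧ ∀ x, theta τ (x + a) = c * theta τ x := by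
    intro a
    induction a using Int.induction_on with
    | zero => exact ⟨1, one_ne_zero, by simp⟩
    | succ i ih =>
      obtain ⟨c, hc, h⟩ := ih
      refine ⟨-c, neg_ne_zero.mpr hc, fun x => ?_⟩
      have := theta_add_one (τ := τ) (x + i)
      push_cast at h ⊢
      rw [← add_assoc, this, h]; ring
    | pred i ih =>
      obtain ⟨c, hc, h⟩ := ih
      refine ⟨-c, neg_ne_zero.mpr hc, fun x => ?_⟩
      have := theta_add_one (τ := τ) (x - i - 1)
      push_cast at h ⊢
      rw [sub_add_cancel, sub_eq_add_neg x, h] at this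
      rw [show x + (-(i : ℂ) - 1) = x + -(i : ℂ) - 1 by ring]
      linear_combination this
  have h2 : ∀ b : ℤ, ∃ E : ℂ → ℂ, Differentiable ℂ E ∧ (∀ x, E x ≠ 0) ∧
      ∀ x, theta τ (x + b * τ) = E x * theta τ x := by
    intro b
    induction b using Int.induction_on with
    | zero => exact ⟨fun _ => 1, by fun_prop, by simp, by simp⟩
    | succ i ih =>
      obtain ⟨E, hE, hE0, h⟩ := ih
      refine ⟨fun x => -exp (-(Real.pi * I * τ) - 2 * Real.pi * I * (x + i * τ)) * E x,
        by fun_prop, fun x => mul_ne_zero (neg_ne_zero.mpr (exp_ne_zero _)) (hE0 x), fun x => ?_⟩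
      have := theta_add_tau hτ (x + i * τ)
      push_cast at h ⊢
      rw [add_mul, one_mul, ← add_assoc, this, h]; ring
    | pred i ih =>
      obtain ⟨E, hE, hE0, h⟩ := ih
      refine ⟨fun x => -exp (-(-(Real.pi * I * τ) - 2 * Real.pi * I * (x - i * τ - τ))) * E x,
        by fun_prop, fun x => mul_ne_zero (neg_ne_zero.mpr (exp_ne_zero _)) (hE0 x), fun x => ?_⟩
      have := theta_add_tau hτ (x - i * τ - τ)
      have hx := h x
      push_cast at hx ⊢
      rw [sub_add_cancel, show x - i * τ = x + -(i : ℂ) * τ by ring, hx] at this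
      rw [show x + (-(i : ℂ) - 1) * τ = x + -(i : ℂ) * τ - τ by ring, exp_neg,
        show x - i * τ = x + -(i : ℂ) * τ by ring, neg_mul, mul_assoc, this]
      field_simp
  obtain ⟨c, hc, h1⟩ := h1 a
  obtain ⟨E, hE, hE0, h2⟩ := h2 b
  refine ⟨fun x => E (x + a) * c, by fun_prop, fun x => mul_ne_zero (hE0 _) hc, fun x => ?_⟩
  rw [h2, h1]; ring

theorem theta_eq_zero_iff (hτ : 0 < τ.im) {x : ℂ} : theta τ x = 0 ↔ ∃ a b : ℤ, x = a + b * τ := by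
  refine ⟨exists_lattice_of_theta_eq_zero hτ, ?_⟩
  rintro ⟨a, b, rfl⟩
  obtain ⟨E, -, -, h⟩ := theta_add_int_add_int_mul hτ a b
  have := h 0
  rwa [zero_add, theta_zero hτ, mul_zero] at this

theorem deriv_theta_ne_zero (hτ : 0 < τ.im) {x : ℂ} (hx : theta τ x = 0) :
    deriv (theta τ) x ≠ 0 := by
  obtain ⟨a, b, rfl⟩ := exists_lattice_of_theta_eq_zero hτ hx
  obtain ⟨E, hE, hE0, h⟩ := theta_add_int_add_int_mul hτ a b
  have h1 : deriv (fun y => theta τ (y + (a + b * τ))) 0 = deriv (E * theta τ) 0 := by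
    congr 1
    funext y
    rw [← add_assoc]
    exact h y
  rw [deriv_comp_add_const, zero_add, deriv_mul (hE 0) (differentiable_theta hτ 0),
    theta_zero hτ, mul_zero, zero_add] at h1
  rw [h1]
  exact mul_ne_zero (hE0 0) (deriv_theta_zero_ne_zero hτ)

end theta

/-! ### Division and cancellation of entire functions. -/

theorem exists_differentiable_quotient {f h : ℂ → ℂ} (hf : Differentiable ℂ f)
    (hh : Differentiable ℂ h) (hz : ∀ x, h x = 0 → f x = 0 ∧ deriv h x ≠ 0) :
    ∃ g : ℂ → ℂ, Differentiable ℂ g ∧ ∀ x, f x = g x * h x := by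
  classical
  -- At a simple zero of h the quotient takes its limit value f'/h'; near such a point it equals the
  -- quotient of the two `dslope` functions, which is differentiable.
  refine ⟨fun x => if h x = 0 then deriv f x / deriv h x else f x / h x, fun x => ?_, fun x => ?_⟩
  · by_cases hx : h x = 0
    · obtain ⟨hfx, hdx⟩ := hz x hx
      have hdf : Differentiable ℂ (dslope f x) := by
        rw [← differentiableOn_univ, Complex.differentiableOn_dslope univ_mem]
        exact hf.differentiableOn
      have hdh : Differentiable ℂ (dslope h x) := by
        rw [← differentiableOn_univ, Complex.differentiableOn_dslope univ_mem]
        exact hh.differentiableOn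
      have h0 : dslope h x x ≠ 0 := by rwa [dslope_same]
      refine ((hdf x).div (hdh x) h0).congr_of_eventuallyEq ?_
      filter_upwards [(hdh x).continuousAt.eventually_ne h0] with y hy
      by_cases hyx : y = x
      · subst hyx
        simp [hx]
      · have hyx' : y - x ≠ 0 := sub_ne_zero.mpr hyx
        have e1 : dslope h x y = h y / (y - x) := by
          rw [dslope_of_ne _ hyx, slope_def_field, hx, sub_zero]
        have e2 : dslope f x y = f y / (y - x) := by
          rw [dslope_of_ne _ hyx, slope_def_field, hfx, sub_zero]
        have hhy : h y ≠ 0 := by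
          intro hy0
          rw [e1, hy0, zero_div] at hy
          exact hy rfl
        rw [if_neg hhy, Pi.div_apply, e1, e2]
        field_simp
    · refine ((hf x).div (hh x) hx).congr_of_eventuallyEq ?_
      filter_upwards [(hh x).continuousAt.eventually_ne hx] with y hy
      rw [if_neg hy, Pi.div_apply]
  · by_cases hx : h x = 0
    · rw [hx, mul_zero, (hz x hx).1]
    · simp only [if_neg hx]
      rw [div_mul_cancel₀ _ hx]

theorem eq_of_mul_eq_mul {f g h : ℂ → ℂ} (hf : Differentiable ℂ f) (hg : Differentiable ℂ g)
    (hh : Differentiable ℂ h) (h0 : h ≠ 0) (H : ∀ x, f x * h x = g x * h x) : f = g := by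
  obtain ⟨a, ha⟩ := Function.ne_iff.mp h0
  have hev : f =ᶠ[𝓝 a] g := by
    filter_upwards [hh.continuous.continuousAt.eventually_ne ha] with x hx
    exact mul_right_cancel₀ hx (H x)
  exact AnalyticOnNhd.eq_of_eventuallyEq (hf.differentiableOn.analyticOnNhd isOpen_univ)
    (hg.differentiableOn.analyticOnNhd isOpen_univ) hev

/-! ### Fundamental parallelograms and Liouville's theorem. -/

section parallelogram

variable {τ : ℂ}

/-- The closed parallelogram with vertices `w, w+1, w+τ, w+1+τ`. -/
def closedParallelogram (τ w : ℂ) : Set ℂ :=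
  (fun p : ℝ × ℝ => w + p.1 + p.2 * τ) '' (Set.Icc 0 1 ×ˢ Set.Icc 0 1)

theorem isCompact_closedParallelogram (τ w : ℂ) : IsCompact (closedParallelogram τ w) :=
  (isCompact_Icc.prod isCompact_Icc).image (by fun_prop)

theorem parallelogram_subset_closed (τ w : ℂ) :
    parallelogram τ w ⊆ closedParallelogram τ w := by
  rintro _ ⟨a, b, ha, hb, rfl⟩
  exact ⟨(a, b), ⟨⟨ha.1, ha.2.le⟩, ⟨hb.1, hb.2.le⟩⟩, rfl⟩

theorem openParallelogram_subset (τ w : ℂ) : openParallelogram τ w ⊆ parallelogram τ w := by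
  rintro _ ⟨a, b, ha, hb, rfl⟩
  exact ⟨a, b, ⟨ha.1.le, ha.2⟩, ⟨hb.1.le, hb.2⟩, rfl⟩

theorem coord_unique (hτ : 0 < τ.im) {a b c d : ℝ}
    (h : (a : ℂ) + b * τ = c + d * τ) : a = c ∧ b = d := by
  have h1 := congrArg im h
  have h2 := congrArg re h
  simp at h1 h2
  have hb : b = d := h1.resolve_right hτ.ne'
  subst hb
  exact ⟨by linarith, rfl⟩

theorem exists_coord (hτ : 0 < τ.im) (x : ℂ) : ∃ a b : ℝ, x = a + b * τ := by
  refine ⟨x.re - x.im / τ.im * τ.re, x.im / τ.im, ?_⟩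
  apply Complex.ext
  · simp
  · simp [hτ.ne']

theorem exists_add_lattice_mem_parallelogram (hτ : 0 < τ.im) (w x : ℂ) :
    ∃ a b : ℤ, x + a + b * τ ∈ parallelogram τ w := by
  obtain ⟨a, b, h⟩ := exists_coord hτ (x - w)
  refine ⟨-⌊a⌋, -⌊b⌋, Int.fract a, Int.fract b, ⟨Int.fract_nonneg a, Int.fract_lt_one a⟩,
    ⟨Int.fract_nonneg b, Int.fract_lt_one b⟩, ?_⟩
  rw [Int.fract, Int.fract]
  push_cast
  linear_combination h

/-- Coordinate differences lie strictly between -1 and 1 as soon as one point is interior. Allowing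
the other on the boundary is what permits the compactness argument on the closed parallelogram. -/
theorem eq_of_theta_sub_eq_zero (hτ : 0 < τ.im) {w x y : ℂ} (hx : x ∈ openParallelogram τ w)
    (hy : y ∈ closedParallelogram τ w) (h : theta τ (x - y) = 0) : x = y := by
  obtain ⟨a, b, ha, hb, rfl⟩ := hx
  obtain ⟨⟨c, d⟩, ⟨hc, hd⟩, rfl⟩ := hy
  obtain ⟨i, j, hij⟩ := (theta_eq_zero_iff hτ).mp h
  have h2 : (a : ℂ) + b * τ = ((c + i : ℝ) : ℂ) + ((d + j : ℝ) : ℂ) * τ := by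
    push_cast
    linear_combination hij
  obtain ⟨h3, h4⟩ := coord_unique hτ h2
  have hi : i = 0 := by
    have l1 : (-1 : ℝ) < i := by linarith [ha.1, hc.2]
    have l2 : (i : ℝ) < 1 := by linarith [ha.2, hc.1]
    have l1' : -1 < i := by exact_mod_cast l1
    have l2' : i < 1 := by exact_mod_cast l2
    omega
  have hj : j = 0 := by
    have l1 : (-1 : ℝ) < j := by linarith [hb.1, hd.2]
    have l2 : (j : ℝ) < 1 := by linarith [hb.2, hd.1]
    have l1' : -1 < j := by exact_mod_cast l1
    have l2' : j < 1 := by exact_mod_cast l2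
    omega
  simp [hi] at h3
  simp [hj] at h4
  simp [h3, h4]

theorem theta_sub_ne_zero (hτ : 0 < τ.im) {w x y : ℂ} (hx : x ∈ openParallelogram τ w)
    (hy : y ∈ openParallelogram τ w) (h : x ≠ y) : theta τ (x - y) ≠ 0 := fun h0 =>
  h (eq_of_theta_sub_eq_zero hτ hx
    (parallelogram_subset_closed _ _ (openParallelogram_subset _ _ hy)) h0)

theorem isOpen_openParallelogram (hτ : 0 < τ.im) (w : ℂ) : IsOpen (openParallelogram τ w) := by
  have : openParallelogram τ w = {x : ℂ | (x - w).re - (x - w).im / τ.im * τ.re ∈ Set.Ioo (0 : ℝ) 1 ∧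
      (x - w).im / τ.im ∈ Set.Ioo (0 : ℝ) 1} := by
    ext x
    constructor
    · rintro ⟨a, b, ha, hb, rfl⟩
      have e : w + a + b * τ - w = a + b * τ := by ring
      rw [Set.mem_ofPred_eq, e]
      simpa [hτ.ne'] using ⟨ha, hb⟩
    · rintro ⟨ha, hb⟩
      refine ⟨_, _, ha, hb, ?_⟩
      rw [add_assoc, ← sub_eq_iff_eq_add']
      apply Complex.ext
      · simp
      · simp [hτ.ne']
  rw [this]
  refine IsOpen.inter (isOpen_Ioo.preimage ?_) (isOpen_Ioo.preimage ?_) <;> fun_prop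

theorem eq_const_of_norm_periodic (hτ : 0 < τ.im) {f : ℂ → ℂ} (hf : Differentiable ℂ f)
    (h1 : ∀ x, ‖f (x + 1)‖ = ‖f x‖) (h2 : ∀ x, ‖f (x + τ)‖ = ‖f x‖) :
    ∃ c, ∀ x, f x = c := by
  obtain ⟨C, hC⟩ := ((isCompact_closedParallelogram τ 0).image hf.continuous).isBounded.exists_norm_le
  have i1 : ∀ (a : ℤ) x, ‖f (x + a)‖ = ‖f x‖ := by
    intro a x
    have := (show Function.Periodic (fun y => ‖f y‖) 1 from h1).int_mul a x
    simpa using this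
  have i2 : ∀ (a : ℤ) x, ‖f (x + a * τ)‖ = ‖f x‖ := by
    intro a x
    exact (show Function.Periodic (fun y => ‖f y‖) τ from h2).int_mul a x
  refine hf.exists_const_forall_eq_of_bounded (isBounded_iff_forall_norm_le.mpr ⟨C, ?_⟩)
  rintro _ ⟨x, rfl⟩
  obtain ⟨a, b, hab⟩ := exists_add_lattice_mem_parallelogram hτ 0 x
  rw [← i1 a x, ← i2 b]
  exact hC _ ⟨_, parallelogram_subset_closed _ _ hab, rfl⟩

end parallelogram

/-! ### Factorization of theta-polynomials. -/

section thetaPolynomial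

variable {τ : ℂ} {m n : ℕ} {A B A' B' : ℂ} {f g : ℂ → ℂ}

theorem mul_mem_T (hf : f ∈ T τ m A B) (hg : g ∈ T τ n A' B') :
    f * g ∈ T τ (m + n) (A * A') (B * B') := by
  obtain ⟨hf, hf1, hf2⟩ := hf
  obtain ⟨hg, hg1, hg2⟩ := hg
  refine ⟨hf.mul hg, fun x => ?_, fun x => ?_⟩
  · simp only [Pi.mul_apply, hf1, hg1, pow_add]; ring
  · have : exp (-(Real.pi * I * ((m + n : ℕ) : ℂ) * τ) - 2 * Real.pi * I * ((m + n : ℕ) : ℂ) * x) =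
        exp (-(Real.pi * I * m * τ) - 2 * Real.pi * I * m * x) *
        exp (-(Real.pi * I * n * τ) - 2 * Real.pi * I * n * x) := by
      rw [← exp_add]; congr 1; push_cast; ring
    simp only [Pi.mul_apply, hf2, hg2, pow_add, this]; ring

theorem exp_mem_T (τ ν : ℂ) : (fun x => exp (2 * Real.pi * I * ν * x)) ∈
    T τ 0 (exp (2 * Real.pi * I * ν)) (exp (2 * Real.pi * I * (ν * τ))) := by
  refine ⟨by fun_prop, fun x => ?_, fun x => ?_⟩
  · beta_reduce
    rw [pow_zero, mul_one, ← exp_add]; congr 1; ring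
  · simp only [Nat.cast_zero, pow_zero, mul_one, mul_zero, zero_mul, neg_zero, sub_zero, exp_zero]
    rw [← exp_add]; congr 1; ring

theorem theta_sub_mem_T (hτ : 0 < τ.im) (u : ℂ) : (fun x => theta τ (x - u)) ∈
    T τ 1 1 (exp (2 * Real.pi * I * u)) := by
  refine ⟨(differentiable_theta hτ).comp (by fun_prop), fun x => ?_, fun x => ?_⟩
  · beta_reduce
    rw [show x + 1 - u = x - u + 1 by ring, theta_add_one]; ring
  · beta_reduce
    rw [show x + τ - u = x - u + τ by ring, theta_add_tau hτ, pow_one, mul_neg_one, neg_mul,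
      neg_mul, ← exp_add, neg_mul]
    congr 3; push_cast; ring

/-- The product `∏_{a ∈ s} θ(x - u a)`. -/
def thetaFinset (τ : ℂ) {ι : Type*} (s : Finset ι) (u : ι → ℂ) : ℂ → ℂ := fun x =>
  ∏ a ∈ s, theta τ (x - u a)

theorem thetaFinset_mem_T (hτ : 0 < τ.im) {ι : Type*} (s : Finset ι) (u : ι → ℂ) :
    thetaFinset τ s u ∈ T τ s.card 1 (exp (2 * Real.pi * I * ∑ a ∈ s, u a)) := by
  classical
  induction s using Finset.induction_on with
  | empty =>
    refine ⟨by unfold thetaFinset; simp, by simp [thetaFinset], by simp [thetaFinset]⟩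
  | insert a s ha ih =>
    have := mul_mem_T ih (theta_sub_mem_T hτ (u a))
    rw [Finset.card_insert_of_notMem ha, Finset.sum_insert ha, add_comm (u a), mul_add, exp_add]
    rw [mul_one] at this
    convert this using 1
    funext x
    simp only [thetaFinset, Finset.prod_insert ha, Pi.mul_apply]
    ring

theorem thetaFinset_ne_zero (hτ : 0 < τ.im) {ι : Type*} (s : Finset ι) (u : ι → ℂ) :
    thetaFinset τ s u ≠ 0 := by
  classical
  induction s using Finset.induction_on with
  | empty => exact Function.ne_iff.mpr ⟨0, by simp [thetaFinset]⟩
  | insert a s ha ih =>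
    intro h0
    refine ih (eq_of_mul_eq_mul (h := fun x => theta τ (x - u a)) (thetaFinset_mem_T hτ s u).1
      (differentiable_const 0) (theta_sub_mem_T hτ (u a)).1 ?_ fun x => ?_)
    · intro h1
      apply deriv_theta_zero_ne_zero hτ
      have h2 : theta τ = fun _ => 0 := by
        funext x
        have := congrFun h1 (x + u a)
        simpa using this
      rw [h2, deriv_const]
    · have := congrFun h0 x
      simp only [thetaFinset, Finset.prod_insert ha, Pi.zero_apply] at this
      rw [Pi.zero_apply, zero_mul, mul_comm]
      exact this

/-- The function `x ↦ e^{2πiνx} ∏_{a ∈ s} θ(x - u a)`. -/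
def expThetaFinset (τ ν : ℂ) {ι : Type*} (s : Finset ι) (u : ι → ℂ) : ℂ → ℂ :=
  (fun x => exp (2 * Real.pi * I * ν * x)) * thetaFinset τ s u

theorem thetaProd_eq (τ ν : ℂ) {n : ℕ} (u : Fin n → ℂ) :
    thetaProd τ ν u = expThetaFinset τ ν Finset.univ u := rfl

theorem expThetaFinset_mem_T (hτ : 0 < τ.im) {ι : Type*} (s : Finset ι) (ν : ℂ) (u : ι → ℂ) :
    expThetaFinset τ ν s u ∈ T τ s.card (exp (2 * Real.pi * I * ν)) (exp (2 * Real.pi * I * (ν * τ + ∑ a ∈ s, u a))) := by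
  have := mul_mem_T (exp_mem_T τ ν) (thetaFinset_mem_T hτ s u)
  rw [mul_one, zero_add, ← exp_add, ← mul_add] at this
  exact this

theorem expThetaFinset_ne_zero (hτ : 0 < τ.im) {ι : Type*} (s : Finset ι) (ν : ℂ)
    (u : ι → ℂ) : expThetaFinset τ ν s u ≠ 0 := by
  intro h
  apply thetaFinset_ne_zero hτ s u
  funext x
  have := congrFun h x
  exact (mul_eq_zero.mp this).resolve_left (exp_ne_zero _)

theorem T_apply_eq_zero_of_lattice (hA : A ≠ 0) (hB : B ≠ 0) (hf : f ∈ T τ m A B) {x : ℂ}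
    (hx : f x = 0) (a b : ℤ) : f (x + a + b * τ) = 0 := by
  obtain ⟨-, h1, h2⟩ := hf
  have hs : ((-1 : ℂ) ^ m) ≠ 0 := pow_ne_zero _ (by norm_num)
  have i1 : ∀ y, f (y + 1) = 0 ↔ f y = 0 := fun y => by
    rw [h1]; simp [hA, hs]
  have i2 : ∀ y, f (y + τ) = 0 ↔ f y = 0 := fun y => by
    rw [h2]; simp [hB, hs, exp_ne_zero]
  -- Nonzero multipliers make the proposition "f vanishes at y" itself doubly periodic, so integer
  -- multiples of the periods come for free.
  have j1 := (show Function.Periodic (fun y => (f y = 0 : Prop)) 1 from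
    fun y => propext (i1 y)).int_mul a x
  have j2 := (show Function.Periodic (fun y => (f y = 0 : Prop)) τ from
    fun y => propext (i2 y)).int_mul b (x + a)
  simp only [mul_one] at j1
  rw [j2, j1]
  exact hx

/-- The zeros of θ(x - u) are simple and form one lattice coset, on which f vanishes too, so the
quotient is entire. Its multipliers follow by cancelling θ(x - u). -/
theorem exists_mul_theta_of_apply_eq_zero (hτ : 0 < τ.im) (hA : A ≠ 0) (hB : B ≠ 0)
    (hf : f ∈ T τ (m + 1) A B) {u : ℂ} (hu : f u = 0) :
    ∃ g ∈ T τ m A (B * exp (-(2 * Real.pi * I * u))), f = g * fun x => theta τ (x - u) := by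
  have hθ := theta_sub_mem_T hτ u
  obtain ⟨g, hg, hfg⟩ := exists_differentiable_quotient hf.1 hθ.1 (fun x hx => by
    refine ⟨?_, ?_⟩
    · obtain ⟨a, b, hab⟩ := (theta_eq_zero_iff hτ).mp hx
      have := T_apply_eq_zero_of_lattice hA hB hf hu a b
      rwa [add_assoc, ← hab, add_sub_cancel] at this
    · rw [deriv_comp_sub_const]
      exact deriv_theta_ne_zero hτ hx)
  have hθ0 : (fun x => theta τ (x - u)) ≠ 0 := by
    have := thetaFinset_ne_zero hτ {()} (fun _ => u)
    unfold thetaFinset at this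
    simpa only [Finset.prod_singleton] using this
  refine ⟨g, ⟨hg, ?_, ?_⟩, funext hfg⟩
  · refine congrFun (eq_of_mul_eq_mul (hg.comp (by fun_prop)) (hg.const_mul _) hθ.1 hθ0 fun x => ?_)
    have h1 := hf.2.1 x
    have h2 := hθ.2.1 x
    rw [hfg, hfg] at h1
    simp only [pow_succ] at h1 h2 ⊢
    simp only [h2] at h1
    linear_combination -h1
  · refine congrFun (eq_of_mul_eq_mul (hg.comp (by fun_prop)) (Differentiable.mul (by fun_prop) hg)
      hθ.1 hθ0 fun x => ?_)
    have h1 := hf.2.2 x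
    have h2 := hθ.2.2 x
    rw [hfg, hfg] at h1
    simp only [h2] at h1
    have e : exp (-(Real.pi * I * ((m + 1 : ℕ) : ℂ) * τ) - 2 * Real.pi * I * ((m + 1 : ℕ) : ℂ) * x) =
        exp (-(Real.pi * I * m * τ) - 2 * Real.pi * I * m * x) *
        exp (-(Real.pi * I * (1 : ℕ) * τ) - 2 * Real.pi * I * (1 : ℕ) * x) := by
      rw [← exp_add]; congr 1; push_cast; ring
    rw [e] at h1
    rw [exp_neg]
    have n1 := exp_ne_zero (2 * Real.pi * I * u)
    have n2 := exp_ne_zero (-(Real.pi * I * (1 : ℕ) * τ) - 2 * Real.pi * I * (1 : ℕ) * x)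
    generalize exp (2 * Real.pi * I * u) = E1 at *
    generalize exp (-(Real.pi * I * (1 : ℕ) * τ) - 2 * Real.pi * I * (1 : ℕ) * x) = E2 at *
    simp only [pow_succ] at h1 ⊢
    apply mul_left_cancel₀ (mul_ne_zero n1 n2)
    linear_combination -h1 - E2 * B * (-1) ^ m *
      exp (-(Real.pi * I * m * τ) - 2 * Real.pi * I * m * x) * g x * theta τ (x - u) *
        mul_inv_cancel₀ n1

theorem exists_eq_exp_of_mem_T_zero (hτ : 0 < τ.im) (hA : A ≠ 0) (hB : B ≠ 0)
    (hf : f ∈ T τ 0 A B) : ∃ c ν : ℂ, f = c • fun x => exp (2 * Real.pi * I * ν * x) := by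
  obtain ⟨hf, h1, h2⟩ := hf
  simp only [Nat.cast_zero, pow_zero, mul_one, mul_zero, zero_mul, neg_zero, sub_zero,
    exp_zero] at h1 h2
  obtain ⟨α, rfl⟩ : ∃ α, exp α = A := ⟨log A, exp_log hA⟩
  obtain ⟨β, rfl⟩ : ∃ β, exp β = B := ⟨log B, exp_log hB⟩
  -- κ solves Re(α + κ) = 0 and Re(β + κτ) = 0, so f(x)e^{κx} has doubly periodic modulus and
  -- Liouville's theorem applies.
  set κ : ℂ := ⟨-α.re, (β.re - α.re * τ.re) / τ.im⟩ with hκ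
  obtain ⟨c, hc⟩ := eq_const_of_norm_periodic hτ (f := fun x => f x * exp (κ * x)) (by fun_prop)
    (fun x => by
      rw [h1, mul_add, mul_one, exp_add, show exp α * f x * (exp (κ * x) * exp κ) =
        exp (α + κ) * (f x * exp (κ * x)) by rw [exp_add]; ring, norm_mul, norm_exp]
      simp [hκ])
    (fun x => by
      rw [h2, mul_add, exp_add, show exp β * f x * (exp (κ * x) * exp (κ * τ)) =
        exp (β + κ * τ) * (f x * exp (κ * x)) by rw [exp_add]; ring, norm_mul, norm_exp]
      have : (β + κ * τ).re = 0 := by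
        simp only [hκ, add_re, mul_re]
        field_simp
        ring
      rw [this, Real.exp_zero, one_mul])
  refine ⟨c, -κ / (2 * Real.pi * I), funext fun x => ?_⟩
  have := hc x
  rw [Pi.smul_apply, smul_eq_mul, mul_div_cancel₀ _ two_pi_I_ne_zero, neg_mul, exp_neg, ← this,
    mul_assoc, mul_inv_cancel₀ (exp_ne_zero _), mul_one]

/-- Without zeros, ψ = f'/f would be entire with ψ(x+1) = ψ(x) and ψ(x+τ) = ψ(x) - 2πim. Then ψ' is
elliptic, hence constant, ψ is affine, period 1 makes it constant, and the second relation gives m =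
0. -/
theorem exists_apply_eq_zero (hτ : 0 < τ.im) (hA : A ≠ 0) (hB : B ≠ 0) (hm : m ≠ 0)
    (hf : f ∈ T τ m A B) : ∃ x, f x = 0 := by
  by_contra! hne
  obtain ⟨hf, h1, h2⟩ := hf
  have hs : ((-1 : ℂ) ^ m) ≠ 0 := pow_ne_zero _ (by norm_num)
  have hdf : Differentiable ℂ (deriv f) := (hf.contDiff (n := 2)).differentiable_deriv_two
  set ψ : ℂ → ℂ := fun x => deriv f x / f x with hψ
  have hψd : Differentiable ℂ ψ := hdf.div hf hne
  have p1 : ∀ x, ψ (x + 1) = ψ x := by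
    intro x
    have e : deriv (fun y => f (y + 1)) x = deriv (fun y => A * (-1) ^ m * f y) x := by
      congr 1; funext y; exact h1 y
    rw [deriv_comp_add_const, deriv_const_mul _ (hf x)] at e
    simp only [hψ]
    rw [e, h1, mul_div_mul_left _ _ (mul_ne_zero hA hs)]
  have p2 : ∀ x, ψ (x + τ) = ψ x - 2 * Real.pi * I * m := by
    intro x
    have e : deriv (fun y => f (y + τ)) x = deriv (fun y => B * (-1) ^ m *
        exp (-(Real.pi * I * m * τ) - 2 * Real.pi * I * m * y) * f y) x := by
      congr 1; funext y; exact h2 y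
    have d1 : HasDerivAt (fun y : ℂ => -(Real.pi * I * m * τ) - 2 * Real.pi * I * m * y)
        (-(2 * Real.pi * I * m)) x := by
      simpa using ((hasDerivAt_id x).const_mul (2 * Real.pi * I * m : ℂ)).const_sub
        (-(Real.pi * I * m * τ) : ℂ)
    have d2 := ((d1.cexp.const_mul (B * (-1) ^ m)).mul (hf x).hasDerivAt).deriv
    rw [deriv_comp_add_const] at e
    have d3 := e.trans d2
    simp only [hψ]
    rw [d3, h2]
    have := hne x
    have n2 := exp_ne_zero (-(Real.pi * I * m * τ) - 2 * Real.pi * I * m * x)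
    field_simp
    ring
  have hdψ : Differentiable ℂ (deriv ψ) := (hψd.contDiff (n := 2)).differentiable_deriv_two
  obtain ⟨c, hc⟩ := eq_const_of_norm_periodic hτ hdψ
    (fun x => by
      rw [← deriv_comp_add_const]
      congr 2; funext y; exact p1 y)
    (fun x => by
      rw [← deriv_comp_add_const, show (fun y => ψ (y + τ)) = fun y => ψ y - 2 * Real.pi * I * m from
        funext p2, deriv_sub_const])
  have hlin : ∀ x y, ψ x - c * x = ψ y - c * y := by
    refine is_const_of_deriv_eq_zero (f := fun x => ψ x - c * x) (by fun_prop) fun x => ?_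
    have := ((hψd x).hasDerivAt.sub ((hasDerivAt_id x).const_mul c)).deriv
    rw [hc, mul_one, sub_self] at this
    exact this
  have l1 := hlin (0 + 1) 0
  have l2 := hlin (0 + τ) 0
  rw [p1] at l1
  rw [p2] at l2
  have hc0 : c = 0 := by linear_combination -l1
  rw [hc0] at l2
  have : (2 * Real.pi * I) * (m : ℂ) = 0 := by linear_combination -l2
  exact (mul_ne_zero two_pi_I_ne_zero (Nat.cast_ne_zero.mpr hm)) this

theorem exists_eq_thetaProd (hτ : 0 < τ.im) (w : ℂ) (hA : A ≠ 0) (hB : B ≠ 0)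
    (hf : f ∈ T τ m A B) (hf0 : f ≠ 0) :
    ∃ (c ν : ℂ) (u : Fin m → ℂ), c ≠ 0 ∧ (∀ j, u j ∈ parallelogram τ w) ∧
      f = c • thetaProd τ ν u := by
  induction m generalizing f B with
  | zero =>
    obtain ⟨c, ν, rfl⟩ := exists_eq_exp_of_mem_T_zero hτ hA hB hf
    refine ⟨c, ν, Fin.elim0, ?_, fun j => j.elim0, ?_⟩
    · rintro rfl; exact hf0 (zero_smul _ _)
    · congr 1; funext x; simp [thetaProd]
  | succ m ih =>
    obtain ⟨v, hv⟩ := exists_apply_eq_zero hτ hA hB (Nat.succ_ne_zero m) hf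
    obtain ⟨a, b, hab⟩ := exists_add_lattice_mem_parallelogram hτ w v
    have hu := T_apply_eq_zero_of_lattice hA hB hf hv a b
    obtain ⟨g, hg, rfl⟩ := exists_mul_theta_of_apply_eq_zero hτ hA hB hf hu
    obtain ⟨c, ν, u, hc, huw, rfl⟩ := ih (mul_ne_zero hB (exp_ne_zero _)) hg (by
      rintro rfl; exact hf0 (zero_mul _))
    refine ⟨c, ν, Fin.cons (v + a + b * τ) u, hc, Fin.cases hab huw, funext fun x => ?_⟩
    simp only [Pi.mul_apply, Pi.smul_apply, thetaProd, Fin.prod_univ_succ, Fin.cons_zero,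
      Fin.cons_succ, smul_eq_mul]
    ring

/-- As many inequivalent zeros as the degree leave a factor of degree 0. After division by one θ(x -
u a), the other zeros persist because that factor does not vanish at them. -/
theorem exists_eq_expThetaFinset (hτ : 0 < τ.im) {ι : Type*} (s : Finset ι) (u : ι → ℂ)
    (hu : ∀ a ∈ s, ∀ b ∈ s, a ≠ b → theta τ (u a - u b) ≠ 0) (hA : A ≠ 0) (hB : B ≠ 0)
    (hf : f ∈ T τ s.card A B) (hfu : ∀ a ∈ s, f (u a) = 0) :
    ∃ c ν : ℂ, f = c • expThetaFinset τ ν s u := by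
  classical
  induction s using Finset.induction_on generalizing f B with
  | empty =>
    obtain ⟨c, ν, rfl⟩ := exists_eq_exp_of_mem_T_zero hτ hA hB hf
    exact ⟨c, ν, by funext x; simp [expThetaFinset, thetaFinset]⟩
  | insert a s ha ih =>
    rw [Finset.card_insert_of_notMem ha] at hf
    obtain ⟨g, hg, rfl⟩ := exists_mul_theta_of_apply_eq_zero hτ hA hB hf
      (hfu a (Finset.mem_insert_self a s))
    obtain ⟨c, ν, rfl⟩ := ih (fun b hb d hd => hu b (Finset.mem_insert_of_mem hb) d
      (Finset.mem_insert_of_mem hd)) (mul_ne_zero hB (exp_ne_zero _)) hg (fun b hb => by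
        refine (mul_eq_zero.mp (hfu b (Finset.mem_insert_of_mem hb))).resolve_right ?_
        exact hu b (Finset.mem_insert_of_mem hb) a (Finset.mem_insert_self a s)
          (by rintro rfl; exact ha hb))
    refine ⟨c, ν, funext fun x => ?_⟩
    simp only [Pi.mul_apply, Pi.smul_apply, expThetaFinset, thetaFinset, Finset.prod_insert ha,
      smul_eq_mul]
    ring

end thetaPolynomial

/-! ### The Wronski equation as a perturbed product equation. -/

theorem deriv_thetaFinset {τ : ℂ} (hτ : 0 < τ.im) {ι : Type*} [DecidableEq ι] (s : Finset ι) (u : ι → ℂ) (x : ℂ) :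
    deriv (thetaFinset τ s u) x =
      ∑ b ∈ s, deriv (theta τ) (x - u b) * ∏ d ∈ s.erase b, theta τ (x - u d) := by
  have : ∀ b ∈ s, DifferentiableAt ℂ (fun y => theta τ (y - u b)) x := fun b _ =>
    ((differentiable_theta hτ).comp (by fun_prop)) x
  unfold thetaFinset
  rw [deriv_fun_finsetProd this]
  refine Finset.sum_congr rfl fun b _ => ?_
  rw [deriv_comp_sub_const, smul_eq_mul, mul_comm]

section perturbation

variable {τ : ℂ} {ι : Type*} [Fintype ι] [DecidableEq ι]

/-- The function `∏_b θ(x - u b) - ε ∑_b c b θ'(x - u b) ∏_{d ≠ b} θ(x - u d)`. -/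
def perturbedProd (τ : ℂ) (c : ι → ℂ) (ε : ℂ) (u : ι → ℂ) (x : ℂ) : ℂ :=
  ∏ b, theta τ (x - u b) -
    ε * ∑ b, c b * deriv (theta τ) (x - u b) * ∏ d ∈ Finset.univ.erase b, theta τ (x - u d)

/-- The values of `perturbedProd` at the points `z a`, as a function of `(ε, u)`. -/
def perturbedValues (τ : ℂ) (c z : ι → ℂ) (p : ℂ × (ι → ℂ)) : ι → ℂ := fun a =>
  perturbedProd τ c p.1 p.2 (z a)

theorem contDiff_perturbedValues (hτ : 0 < τ.im) (c z : ι → ℂ) :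
    ContDiff ℂ 1 (perturbedValues τ c z) := by
  have h1 : ContDiff ℂ 2 (theta τ) := (differentiable_theta hτ).contDiff
  have h2 : ContDiff ℂ 1 (deriv (theta τ)) := by
    have : Differentiable ℂ (deriv (theta τ)) := h1.differentiable_deriv_two
    exact this.contDiff
  have h3 : ContDiff ℂ 1 (theta τ) := h1.of_le (by norm_num)
  have e1 : ∀ a b : ι, ContDiff ℂ 1 fun p : ℂ × (ι → ℂ) => theta τ (z a - p.2 b) := fun a b =>
    h3.comp (by fun_prop)
  have e2 : ∀ a b : ι, ContDiff ℂ 1 fun p : ℂ × (ι → ℂ) => deriv (theta τ) (z a - p.2 b) :=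
    fun a b => h2.comp (by fun_prop)
  rw [contDiff_pi]
  intro a
  refine (contDiff_prod fun b _ => e1 a b).sub (contDiff_fst.mul (ContDiff.sum fun b _ => ?_))
  exact (contDiff_const.mul (e2 a b)).mul (contDiff_prod fun d _ => e1 a d)

theorem perturbedValues_base (hτ : 0 < τ.im) (c z : ι → ℂ) : perturbedValues τ c z (0, z) = 0 := by
  funext a
  simp only [perturbedValues, perturbedProd, zero_mul, sub_zero, Pi.zero_apply]
  exact Finset.prod_eq_zero (Finset.mem_univ a) (by rw [sub_self, theta_zero hτ])

/-- At ε = 0 and u = z the Jacobian is diagonal: in row a, every term of the product rule except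
that of b = a retains the factor θ(z a - z a) = 0. -/
theorem isInvertible_fderiv_perturbedValues (hτ : 0 < τ.im) (c z : ι → ℂ)
    (hz : ∀ a b, a ≠ b → theta τ (z a - z b) ≠ 0) :
    (fderiv ℂ (perturbedValues τ c z) (0, z) ∘L .inr ℂ ℂ (ι → ℂ)).IsInvertible := by
  set d : ι → ℂ := fun a =>
    (∏ b ∈ Finset.univ.erase a, theta τ (z a - z b)) * -deriv (theta τ) 0 with hd
  have hd0 : ∀ a, d a ≠ 0 := fun a => mul_ne_zero
    (Finset.prod_ne_zero_iff.mpr fun b hb => hz a b (Finset.ne_of_mem_erase hb).symm)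
    (neg_ne_zero.mpr (deriv_theta_zero_ne_zero hτ))
  have h1 : HasFDerivAt (fun u : ι → ℂ => perturbedValues τ c z (0, u))
      (fderiv ℂ (perturbedValues τ c z) (0, z) ∘L .inr ℂ ℂ (ι → ℂ)) z :=
    (((contDiff_perturbedValues hτ c z).differentiable one_ne_zero (0, z)).hasFDerivAt).comp z
      (hasFDerivAt_prodMk_right 0 z)
  have h2 : HasFDerivAt (fun u : ι → ℂ => perturbedValues τ c z (0, u))
      (ContinuousLinearMap.pi fun a => d a • ContinuousLinearMap.proj (R := ℂ) (φ := fun _ => ℂ) a)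
      z := by
    rw [hasFDerivAt_pi]
    intro a
    have h3 : ∀ b : ι, HasFDerivAt (fun u : ι → ℂ => theta τ (z a - u b))
        (-deriv (theta τ) (z a - z b) •
          ContinuousLinearMap.proj (R := ℂ) (φ := fun _ : ι => ℂ) b) z := by
      intro b
      have := ((differentiable_theta hτ (z a - z b)).hasDerivAt).comp_hasFDerivAt z
        ((ContinuousLinearMap.proj (R := ℂ) (φ := fun _ : ι => ℂ) b).hasFDerivAt.const_sub (z a))
      refine this.congr_fderiv ?_
      ext v
      simp
    have h4 := HasFDerivAt.finsetProd (u := Finset.univ) fun b _ => h3 b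
    have h5 : (fun u : ι → ℂ => perturbedValues τ c z (0, u) a) =
        fun u => ∏ b, theta τ (z a - u b) := by
      funext u
      simp [perturbedValues, perturbedProd]
    rw [h5]
    refine h4.congr_fderiv ?_
    rw [Finset.sum_eq_single a]
    · rw [smul_smul, sub_self]
    · intro b _ hb
      rw [Finset.prod_eq_zero (Finset.mem_erase.mpr ⟨hb.symm, Finset.mem_univ a⟩)
        (by rw [sub_self, theta_zero hτ])]
      ext v
      simp
    · intro h; exact absurd (Finset.mem_univ a) h
  rw [h1.unique h2]
  refine ContinuousLinearMap.IsInvertible.of_inverse (g := ContinuousLinearMap.pi fun a =>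
    (d a)⁻¹ • ContinuousLinearMap.proj (R := ℂ) (φ := fun _ => ℂ) a) ?_ ?_
  · ext v a
    simp [hd0 a]
  · ext v a
    simp [hd0 a]

/-- Implicit function theorem at (0, z). The radius r is chosen before ε, so it can meet further
smallness conditions first. -/
theorem exists_unique_perturbed_zero (hτ : 0 < τ.im) (c z : ι → ℂ)
    (hz : ∀ a b, a ≠ b → theta τ (z a - z b) ≠ 0) :
    ∀ᶠ r : ℝ in 𝓝[>] 0, ∀ᶠ ε : ℂ in 𝓝 0,
      ∃! u : ι → ℂ, dist u z < r ∧ perturbedValues τ c z (ε, u) = 0 := by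
  have hc : ContDiffAt ℂ 1 (perturbedValues τ c z) (0, z) :=
    (contDiff_perturbedValues hτ c z).contDiffAt
  have hi := isInvertible_fderiv_perturbedValues hτ c z hz
  set ψ := hc.implicitFunction one_ne_zero hi with hψ
  have h1 := hc.eventually_apply_eq_iff_implicitFunction one_ne_zero hi
  have h2 : ψ 0 = z := hc.implicitFunction_apply_self one_ne_zero hi
  have h3 : ContinuousAt ψ 0 :=
    (hc.hasStrictFDerivAt_implicitFunction one_ne_zero hi).hasFDerivAt.continuousAt
  rw [perturbedValues_base hτ, ← hψ] at h1
  obtain ⟨ρ, hρ, h1⟩ := Metric.eventually_nhds_iff.mp h1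
  -- Within distance ρ of (0, z) the zero set is the graph of `ψ`, so every r ≤ ρ gives uniqueness;
  -- continuity of `ψ` then bounds ε so that `ψ ε` stays within r of z.
  filter_upwards [Ioc_mem_nhdsGT hρ] with r ⟨hr, hrρ⟩
  obtain ⟨δ, hδ, h4⟩ := Metric.continuousAt_iff.mp h3 r hr
  rw [h2] at h4
  filter_upwards [Metric.ball_mem_nhds 0 hδ, Metric.ball_mem_nhds 0 hρ] with ε hεδ hερ
  have hiff : ∀ u : ι → ℂ, dist u z < r → (perturbedValues τ c z (ε, u) = 0 ↔ ψ ε = u) :=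
    fun u hu => h1 (by rw [Prod.dist_eq]; exact max_lt hερ (hu.trans_le hrρ))
  refine ⟨ψ ε, ⟨h4 hεδ, (hiff _ (h4 hεδ)).mpr rfl⟩, fun u hu => ?_⟩
  exact ((hiff u hu.1).mp hu.2).symm

/-- On the compact set `K` of configurations not r-close to any permutation of z there is no
solution at ε = 0, hence none for nearby ε. -/
theorem exists_perm_of_perturbed_zero (hτ : 0 < τ.im) {w : ℂ} (c z : ι → ℂ)
    (hz : ∀ a, z a ∈ openParallelogram τ w) (hzi : Function.Injective z) {r : ℝ} (hr : 0 < r) :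
    ∀ᶠ ε : ℂ in 𝓝 0, ∀ u : ι → ℂ, (∀ a, u a ∈ closedParallelogram τ w) →
      perturbedValues τ c z (ε, u) = 0 → ∃ σ : Equiv.Perm ι, ∀ a, dist (u a) (z (σ a)) < r := by
  set K : Set (ι → ℂ) := (Set.univ.pi fun _ => closedParallelogram τ w) ∩
    ⋂ σ : Equiv.Perm ι, ⋃ a : ι, {u | r ≤ dist (u a) (z (σ a))} with hK
  have hKc : IsCompact K := by
    refine (isCompact_univ_pi fun _ => isCompact_closedParallelogram τ w).inter_right ?_
    refine isClosed_iInter fun σ => isClosed_iUnion_of_finite fun a => ?_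
    exact isClosed_le continuous_const (by fun_prop)
  have h := hKc.eventually_forall_of_forall_eventually (x₀ := (0 : ℂ))
    (P := fun ε u => perturbedValues τ c z (ε, u) ≠ 0) (fun u hu => by
      refine (contDiff_perturbedValues hτ c z).continuous.continuousAt.eventually_ne ?_
      intro h0
      have h1 : ∀ a, ∃ b, z a = u b := by
        intro a
        have := congrFun h0 a
        simp only [perturbedValues, perturbedProd, zero_mul, sub_zero, Pi.zero_apply,
          Finset.prod_eq_zero_iff] at this
        obtain ⟨b, -, hb⟩ := this
        exact ⟨b, eq_of_theta_sub_eq_zero hτ (hz a) (hu.1 b (Set.mem_univ b)) hb⟩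
      choose e he using h1
      -- Each z a occurs among the u b; since the z a are distinct and there are equally many u b,
      -- this matching is a bijection.
      have hei : Function.Injective e := fun a b hab => hzi (by rw [he a, he b, hab])
      let σ : Equiv.Perm ι := Equiv.ofBijective e (Finite.injective_iff_bijective.mp hei)
      obtain ⟨a, ha⟩ := Set.mem_iUnion.mp (Set.mem_iInter.mp hu.2 σ.symm)
      have h2 : z (σ.symm a) = u a := by
        rw [he]
        exact congrArg u (σ.apply_symm_apply a)
      have h3 : r ≤ dist (u a) (z (σ.symm a)) := ha
      rw [h2, dist_self] at h3
      exact absurd hr h3.not_gt)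
  filter_upwards [h] with ε h u hu h0
  by_contra! hcon
  refine h u ⟨fun a _ => hu a, ?_⟩ h0
  exact Set.mem_iInter.mpr fun σ => Set.mem_iUnion.mpr (hcon σ)

/-- At x = u a only the term b = a of the sum survives. This is what separates the zeros of f and g
from those of h. -/
theorem perturbedProd_apply_self_ne_zero (hτ : 0 < τ.im) {c : ι → ℂ} {ε : ℂ} {u : ι → ℂ} {a : ι}
    (hε : ε ≠ 0) (hc : c a ≠ 0) (hu : ∀ b, a ≠ b → theta τ (u a - u b) ≠ 0) :
    perturbedProd τ c ε u (u a) ≠ 0 := by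
  have h0 : theta τ (u a - u a) = 0 := by rw [sub_self, theta_zero hτ]
  rw [perturbedProd, Finset.prod_eq_zero (Finset.mem_univ a) h0, zero_sub, Finset.sum_eq_single a]
  · refine neg_ne_zero.mpr (mul_ne_zero hε (mul_ne_zero (mul_ne_zero hc
      (deriv_theta_ne_zero hτ h0)) ?_))
    exact Finset.prod_ne_zero_iff.mpr fun b hb => hu b (Finset.ne_of_mem_erase hb).symm
  · intro b _ hb
    rw [Finset.prod_eq_zero (Finset.mem_erase.mpr ⟨hb.symm, Finset.mem_univ a⟩) h0, mul_zero]
  · intro h; exact absurd (Finset.mem_univ a) h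

/-- The sign vector which is `-1` on `I` and `1` off `I`. -/
def signVector (I : Finset ι) (a : ι) : ℂ := if a ∈ I then -1 else 1

theorem wr_thetaFinset_compl (hτ : 0 < τ.im) (I : Finset ι) (u : ι → ℂ) (x : ℂ) :
    wr (thetaFinset τ I u) (thetaFinset τ Iᶜ u) x =
      ∑ b, signVector I b * deriv (theta τ) (x - u b) *
        ∏ d ∈ Finset.univ.erase b, theta τ (x - u d) := by
  have hsplit : ∀ b, ∏ d ∈ Finset.univ.erase b, theta τ (x - u d) =
      (∏ d ∈ I.erase b, theta τ (x - u d)) * ∏ d ∈ Iᶜ.erase b, theta τ (x - u d) := by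
    intro b
    rw [← Finset.prod_union (Disjoint.mono (Finset.erase_subset _ _) (Finset.erase_subset _ _)
      disjoint_compl_right), ← Finset.erase_union_distrib, Finset.union_compl]
  rw [← Finset.sum_add_sum_compl I]
  simp only [wr]
  rw [deriv_thetaFinset hτ, deriv_thetaFinset hτ, Finset.mul_sum, Finset.sum_mul, sub_eq_neg_add,
    ← Finset.sum_neg_distrib]
  congr 1
  · refine Finset.sum_congr rfl fun b hb => ?_
    rw [hsplit, Finset.erase_eq_of_notMem (s := Iᶜ) (by simpa using hb), signVector, if_pos hb,
      thetaFinset]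
    ring
  · refine Finset.sum_congr rfl fun b hb => ?_
    rw [Finset.mem_compl] at hb
    rw [hsplit, Finset.erase_eq_of_notMem (s := I) hb, signVector, if_neg hb, thetaFinset]
    ring

theorem wr_exp_mul {f g : ℂ → ℂ} (hf : Differentiable ℂ f) (hg : Differentiable ℂ g)
    (κ ν x : ℂ) :
    wr ((fun x => exp (2 * Real.pi * I * κ * x)) * f)
      ((fun x => exp (2 * Real.pi * I * ν * x)) * g) x =
    exp (2 * Real.pi * I * (κ + ν) * x) *
      (2 * Real.pi * I * (ν - κ) * (f x * g x) + wr f g x) := by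
  have hE : ∀ κ : ℂ, HasDerivAt (fun x => exp (2 * Real.pi * I * κ * x))
      (exp (2 * Real.pi * I * κ * x) * (2 * Real.pi * I * κ)) x := fun κ => by
    simpa using ((hasDerivAt_id x).const_mul (2 * Real.pi * I * κ)).cexp
  have e1 := ((hE κ).mul (hf x).hasDerivAt).deriv
  have e2 := ((hE ν).mul (hg x).hasDerivAt).deriv
  have e3 : exp (2 * Real.pi * I * (κ + ν) * x) =
      exp (2 * Real.pi * I * κ * x) * exp (2 * Real.pi * I * ν * x) := by
    rw [← exp_add]; congr 1; ring
  simp only [wr]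
  rw [e1, e2, e3]
  simp only [Pi.mul_apply]
  ring

/-- Differentiating the exponentials contributes 2πi(ν - κ) f g, which dominates for large |ν - κ|;
dividing by this coefficient makes the Wronskian of the theta products the small term. -/
theorem wr_expThetaFinset (hτ : 0 < τ.im) (s : Finset ι) (u : ι → ℂ) {κ ν : ℂ}
    (h : ν ≠ κ) (x : ℂ) :
    wr (expThetaFinset τ κ s u) (expThetaFinset τ ν sᶜ u) x =
    exp (2 * Real.pi * I * (κ + ν) * x) * (2 * Real.pi * I * (ν - κ)) *
      perturbedProd τ (signVector s) (-(2 * Real.pi * I * (ν - κ))⁻¹) u x := by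
  have hne : 2 * Real.pi * I * (ν - κ) ≠ 0 := mul_ne_zero two_pi_I_ne_zero (sub_ne_zero.mpr h)
  rw [expThetaFinset, expThetaFinset, wr_exp_mul (thetaFinset_mem_T hτ s u).1 (thetaFinset_mem_T hτ sᶜ u).1,
    wr_thetaFinset_compl hτ, perturbedProd]
  have : thetaFinset τ s u x * thetaFinset τ sᶜ u x = ∏ b, theta τ (x - u b) := by
    simp only [thetaFinset]
    exact Finset.prod_mul_prod_compl s _
  rw [this]
  generalize 2 * Real.pi * I * (ν - κ) = M at *
  field_simp
  ring

end perturbation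

/-! ### Points of projective space and their representatives. -/

section IsClassOf

variable {p q : Projectivization ℂ (ℂ → ℂ)} {F G : ℂ → ℂ}

theorem isClassOf_mk (hF : F ≠ 0) : IsClassOf (Projectivization.mk ℂ F hF) F :=
  Projectivization.submodule_mk F hF

theorem IsClassOf.mem (h : IsClassOf p F) : F ∈ p.submodule := by
  rw [h]; exact Submodule.mem_span_singleton_self F

theorem IsClassOf.submodule_le_iff (h : IsClassOf p F) {S : Submodule ℂ (ℂ → ℂ)} :
    p.submodule ≤ S ↔ F ∈ S := by
  rw [h, Submodule.span_singleton_le_iff_mem]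

theorem isClassOf_rep (p : Projectivization ℂ (ℂ → ℂ)) : IsClassOf p p.rep :=
  Projectivization.submodule_eq p

theorem IsClassOf.of_smul {c : ℂ} (hc : c ≠ 0) (h : IsClassOf p (c • F)) : IsClassOf p F := by
  unfold IsClassOf at h ⊢
  rw [h, Submodule.span_singleton_smul_eq (IsUnit.mk0 c hc)]

theorem IsClassOf.ne_zero (h : IsClassOf p F) : F ≠ 0 := by
  rintro rfl
  have h1 := (isClassOf_rep p).mem
  rw [h, Submodule.span_zero_singleton, Submodule.mem_bot] at h1
  exact p.rep_nonzero h1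

theorem IsClassOf.exists_eq_smul (hF : IsClassOf p F) (hG : IsClassOf p G) :
    ∃ c : ℂ, c ≠ 0 ∧ F = c • G := by
  have h1 := hF.mem
  rw [hG] at h1
  obtain ⟨c, rfl⟩ := Submodule.mem_span_singleton.mp h1
  refine ⟨c, ?_, rfl⟩
  rintro rfl
  exact hF.ne_zero (zero_smul _ _)

theorem IsClassOf.eq (hp : IsClassOf p F) (hq : IsClassOf q F) : p = q :=
  Projectivization.submodule_injective (hp.trans hq.symm)

end IsClassOf

/-! ### Recovering exponents from multipliers. -/

section labels

variable {τ : ℂ}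

theorem exists_int_of_exp_eq {α β : ℂ}
    (h : exp (2 * Real.pi * I * α) = exp (2 * Real.pi * I * β)) : ∃ n : ℤ, α = β + n := by
  obtain ⟨n, hn⟩ := exp_eq_exp_iff_exists_int.mp h
  refine ⟨n, mul_left_cancel₀ two_pi_I_ne_zero ?_⟩
  rw [hn]; ring

theorem second_multiplier_unique {m : ℕ} {A₁ B₁ A₂ B₂ : ℂ} {f : ℂ → ℂ}
    (h₁ : f ∈ T τ m A₁ B₁) (h₂ : f ∈ T τ m A₂ B₂) (h0 : f ≠ 0) : B₁ = B₂ := by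
  obtain ⟨b, hb⟩ := Function.ne_iff.mp h0
  have hs : ((-1 : ℂ) ^ m) ≠ 0 := pow_ne_zero _ (by norm_num)
  exact mul_right_cancel₀ hs (mul_right_cancel₀ (exp_ne_zero _)
    (mul_right_cancel₀ hb ((h₁.2.2 b).symm.trans (h₂.2.2 b))))

/-- The exponent of a theta-polynomial is determined by its multipliers once the sum of its zeros is
known up to an error of imaginary part less than `Im τ`. -/
theorem exponent_unique (hτ : 0 < τ.im) {m : ℕ} {α β σ ρ : ℂ} {f : ℂ → ℂ}
    (h₁ : f ∈ T τ m (exp (2 * Real.pi * I * α)) (exp (2 * Real.pi * I * (α * τ + σ))))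
    (h₂ : f ∈ T τ m (exp (2 * Real.pi * I * β)) (exp (2 * Real.pi * I * (β * τ + ρ))))
    (h0 : f ≠ 0) (h : |(σ - ρ).im| < τ.im) : α = β := by
  obtain ⟨n, rfl⟩ := exists_int_of_exp_eq (multiplier_unique h₁ h₂ h0)
  obtain ⟨k, hk⟩ := exists_int_of_exp_eq (second_multiplier_unique h₁ h₂ h0)
  -- The first multiplier determines the exponent up to an integer n. Taking imaginary parts here
  -- gives |n| Im τ = |Im(σ - ρ)| < Im τ, so n = 0.
  have h1 : (n : ℂ) * τ + (σ - ρ) = k := by linear_combination hk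
  have h2 := congrArg im h1
  rw [add_im, intCast_im, ← ofReal_intCast, im_ofReal_mul] at h2
  have h3 : |(n : ℝ)| * τ.im < τ.im := by
    rw [← abs_of_pos hτ, ← abs_mul, abs_of_pos hτ, eq_neg_of_add_eq_zero_left h2, abs_neg]
    exact h
  have h4 : |(n : ℝ)| < 1 := by
    by_contra hc
    nlinarith [not_lt.mp hc]
  have h5 : |n| < 1 := by exact_mod_cast h4
  rw [Int.abs_lt_one_iff.mp h5]
  simp

end labels

/-! ### Passing between subsets and ordered families of zeros. -/

section reindexing

variable {τ ν : ℂ}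

theorem expThetaFinset_eq_thetaProd {ι : Type*} {s : Finset ι} {u : ι → ℂ} {m : ℕ}
    (t : Fin m ↪ ι) (ht : Finset.univ.map t = s) :
    expThetaFinset τ ν s u = thetaProd τ ν (u ∘ t) := by
  rw [thetaProd_eq, expThetaFinset, expThetaFinset]
  congr 1
  funext x
  rw [thetaFinset, ← ht, Finset.prod_map]
  rfl

theorem exists_embedding_of_card_eq {ι : Type*} {s : Finset ι} {m : ℕ} (h : s.card = m) :
    ∃ t : Fin m ↪ ι, Finset.univ.map t = s := by
  subst h
  refine ⟨s.equivFin.symm.toEmbedding.trans (Function.Embedding.subtype _), ?_⟩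
  ext a
  simp only [Finset.mem_map, Finset.mem_univ, true_and]
  constructor
  · rintro ⟨j, rfl⟩
    exact (s.equivFin.symm j).2
  · intro ha
    exact ⟨s.equivFin ⟨a, ha⟩, by simp⟩

theorem exists_split_embeddings {ι : Type*} [Fintype ι] [DecidableEq ι] {m : ℕ}
    (e : Fin m ⊕ Fin m ≃ ι) :
    ∃ (s : Finset ι) (t t' : Fin m ↪ ι), Finset.univ.map t = s ∧ Finset.univ.map t' = sᶜ ∧
      (∀ j, t j = e (Sum.inl j)) ∧ ∀ j, t' j = e (Sum.inr j) := by
  refine ⟨Finset.univ.map (Function.Embedding.inl.trans e.toEmbedding),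
    Function.Embedding.inl.trans e.toEmbedding, Function.Embedding.inr.trans e.toEmbedding,
    rfl, ?_, fun j => rfl, fun j => rfl⟩
  ext a
  obtain ⟨b, rfl⟩ := e.surjective a
  rcases b with b | b <;> simp

end reindexing

/-! ### The correspondence between m-subsets and points of the fibre. -/

section count

variable {τ w μ : ℂ} {m : ℕ} {z : Fin (2 * m) → ℂ} {r : ℝ}
  {h : ↥(P τ (2 * m) \ PA τ (2 * m) 1)} {k : ℤ}

/-- The balls of radius `r` around the points `z a` are disjoint, contained in the open
parallelogram, and small enough for the exponents to be determined. -/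
structure IsSmallRadius (τ w : ℂ) {n : ℕ} (z : Fin n → ℂ) (r : ℝ) : Prop where
  pos : 0 < r
  mem_openParallelogram : ∀ a y, dist y (z a) < r → y ∈ openParallelogram τ w
  separated : ∀ a b, a ≠ b → 2 * r ≤ dist (z a) (z b)
  im_bound : n * r ≤ τ.im

theorem eventually_isSmallRadius (hτ : 0 < τ.im) {n : ℕ} {z : Fin n → ℂ}
    (hz : ∀ a, z a ∈ openParallelogram τ w) (hzi : Function.Injective z) :
    ∀ᶠ r in 𝓝[>] 0, IsSmallRadius τ w z r := by
  have h1 : ∀ᶠ r : ℝ in 𝓝[>] 0, ∀ a y, dist y (z a) < r → y ∈ openParallelogram τ w := by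
    rw [eventually_all]
    intro a
    obtain ⟨ρ, hρ, hsub⟩ := Metric.isOpen_iff.mp (isOpen_openParallelogram hτ w) _ (hz a)
    filter_upwards [Ioc_mem_nhdsGT hρ] with r hr y hy
    exact hsub (hy.trans_le hr.2)
  have h2 : ∀ᶠ r : ℝ in 𝓝[>] 0, ∀ a b, a ≠ b → 2 * r ≤ dist (z a) (z b) := by
    rw [eventually_all]
    intro a
    rw [eventually_all]
    intro b
    by_cases hab : a = b
    · exact .of_forall fun r hr => absurd hab hr
    · have hd : 0 < dist (z a) (z b) / 2 := half_pos (dist_pos.mpr (hzi.ne hab))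
      filter_upwards [Ioc_mem_nhdsGT hd] with r hr _
      linarith [hr.2]
  have hpos : 0 < τ.im / (n + 1) := by positivity
  filter_upwards [h1, h2, Ioc_mem_nhdsGT hpos] with r h1 h2 h3
  refine ⟨h3.1, h1, h2, ?_⟩
  have h4 := (le_div_iff₀ (by positivity : (0 : ℝ) < n + 1)).mp h3.2
  nlinarith [h3.1]

theorem IsSmallRadius.eq_of_dist_lt (hr : IsSmallRadius τ w z r) {x : ℂ} {a b : Fin (2 * m)}
    (ha : dist x (z a) < r) (hb : dist x (z b) < r) : a = b := by
  by_contra hab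
  have h1 := hr.separated a b hab
  have h2 := dist_triangle_left (z a) (z b) x
  linarith

theorem IsSmallRadius.theta_sub_ne_zero (hτ : 0 < τ.im) (hr : IsSmallRadius τ w z r)
    {u v : Fin (2 * m) → ℂ} (hu : ∀ a, dist (u a) (z a) < r) (hv : ∀ a, dist (v a) (z a) < r)
    {a b : Fin (2 * m)} (hab : a ≠ b) : theta τ (u a - v b) ≠ 0 := by
  refine EllipticWronski.theta_sub_ne_zero hτ (hr.mem_openParallelogram a _ (hu a))
    (hr.mem_openParallelogram b _ (hv b)) fun h => hab ?_
  refine hr.eq_of_dist_lt (hu a) ?_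
  rw [h]
  exact hv b

theorem IsSmallRadius.abs_im_sum_sub_lt (hm : 0 < m) (hr : IsSmallRadius τ w z r)
    {u : Fin (2 * m) → ℂ} (hu : ∀ a, dist (u a) (z a) < r) :
    |(∑ a, u a - ∑ a, z a).im| < τ.im := by
  rw [← Finset.sum_sub_distrib]
  have : Nonempty (Fin (2 * m)) := ⟨⟨0, by omega⟩⟩
  calc |(∑ a, (u a - z a)).im| ≤ ‖∑ a, (u a - z a)‖ := abs_im_le_norm _
    _ ≤ ∑ a, ‖u a - z a‖ := norm_sum_le _ _
    _ < ∑ _a : Fin (2 * m), r := Finset.sum_lt_sum_of_nonempty Finset.univ_nonempty fun a _ => by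
        rw [← dist_eq_norm]; exact hu a
    _ = (2 * m : ℕ) * r := by simp
    _ ≤ τ.im := hr.im_bound

/-- The pair `p` is represented by theta-polynomials whose zeros lie near the points `z a` with
`a ∈ s` and with `a ∉ s`, respectively. -/
def IsNear (τ μ : ℂ) (z : Fin (2 * m) → ℂ) (r : ℝ) (k : ℤ) (s : Finset (Fin (2 * m)))
    (p : PA τ m 1 × ↥(P τ m \ PA τ m 1)) : Prop :=
  ∃ u : Fin (2 * m) → ℂ, (∀ a, dist (u a) (z a) < r) ∧
    IsClassOf p.1.1 (expThetaFinset τ k s u) ∧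
    IsClassOf p.2.1 (expThetaFinset τ (-(μ + k)) sᶜ u)

theorem exists_wr_eq_smul (hh : IsClassOf h.1 (thetaProd τ (-μ) z))
    {p : PA τ m 1 × ↥(P τ m \ PA τ m 1)} (hp : wronskiMap τ m p = h) {f g : ℂ → ℂ}
    (hf : IsClassOf p.1.1 f) (hg : IsClassOf p.2.1 g) :
    ∃ c : ℂ, c ≠ 0 ∧ wr f g = c • thetaProd τ (-μ) z := by
  have h1 := wronskiMap_isClassOf τ m p hf hg
  rw [hp] at h1
  exact h1.exists_eq_smul hh

theorem thetaProd_apply_self (hτ : 0 < τ.im) (ν : ℂ) {n : ℕ} (z : Fin n → ℂ) (a : Fin n) :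
    thetaProd τ ν z (z a) = 0 := by
  rw [thetaProd, Finset.prod_eq_zero (Finset.mem_univ a) (by rw [sub_self, theta_zero hτ]),
    mul_zero]

theorem wr_apply_eq_zero_iff (hτ : 0 < τ.im) (s : Finset (Fin (2 * m))) (u : Fin (2 * m) → ℂ)
    {κ ν : ℂ} (hν : ν ≠ κ) (x : ℂ) :
    wr (expThetaFinset τ κ s u) (expThetaFinset τ ν sᶜ u) x = 0 ↔
      perturbedProd τ (signVector s) (-(2 * Real.pi * I * (ν - κ))⁻¹) u x = 0 := by
  have hne : 2 * Real.pi * I * (ν - κ) ≠ 0 := mul_ne_zero two_pi_I_ne_zero (sub_ne_zero.mpr hν)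
  rw [wr_expThetaFinset hτ s u hν, mul_eq_zero, or_iff_right (mul_ne_zero (exp_ne_zero _) hne)]

theorem perturbedValues_eq_zero (hτ : 0 < τ.im) (hh : IsClassOf h.1 (thetaProd τ (-μ) z))
    {p : PA τ m 1 × ↥(P τ m \ PA τ m 1)} (hp : wronskiMap τ m p = h)
    {s : Finset (Fin (2 * m))} {u : Fin (2 * m) → ℂ} {κ ν : ℂ} (hν : ν ≠ κ)
    (hf : IsClassOf p.1.1 (expThetaFinset τ κ s u))
    (hg : IsClassOf p.2.1 (expThetaFinset τ ν sᶜ u)) :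
    perturbedValues τ (signVector s) z (-(2 * Real.pi * I * (ν - κ))⁻¹, u) = 0 := by
  obtain ⟨c, -, hc⟩ := exists_wr_eq_smul hh hp hf hg
  funext a
  refine (wr_apply_eq_zero_iff hτ s u hν (z a)).mp ?_
  rw [hc, Pi.smul_apply, thetaProd_apply_self hτ, smul_zero]

theorem wr_expThetaFinset_mem_T (hτ : 0 < τ.im) {s : Finset (Fin (2 * m))} (hs : s.card = m)
    (κ ν : ℂ) (u : Fin (2 * m) → ℂ) :
    wr (expThetaFinset τ κ s u) (expThetaFinset τ ν sᶜ u) ∈ T τ (2 * m)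
      (exp (2 * Real.pi * I * (κ + ν))) (exp (2 * Real.pi * I * ((κ + ν) * τ + ∑ a, u a))) := by
  have h1 := expThetaFinset_mem_T hτ s κ u
  have h2 := expThetaFinset_mem_T hτ sᶜ ν u
  have hs' : sᶜ.card = m := by rw [Finset.card_compl, hs, Fintype.card_fin]; omega
  rw [hs] at h1
  rw [hs'] at h2
  have h3 := wr_mem h1 h2
  rw [← exp_add, ← exp_add] at h3
  convert h3 using 3
  · ring
  · rw [← Finset.sum_add_sum_compl s]; ring

theorem thetaProd_mem_T (hτ : 0 < τ.im) {n : ℕ} (ν : ℂ) (u : Fin n → ℂ) :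
    thetaProd τ ν u ∈ T τ n (exp (2 * Real.pi * I * ν))
      (exp (2 * Real.pi * I * (ν * τ + ∑ a, u a))) := by
  have := expThetaFinset_mem_T hτ Finset.univ ν u
  rwa [Finset.card_univ, Fintype.card_fin] at this

theorem thetaProd_ne_zero (hτ : 0 < τ.im) {n : ℕ} (ν : ℂ) (u : Fin n → ℂ) :
    thetaProd τ ν u ≠ 0 := expThetaFinset_ne_zero hτ Finset.univ ν u

theorem ne_of_im_ne (k : ℤ) (hμ : μ.im ≠ 0) : -(μ + k) ≠ (k : ℂ) := by
  intro h
  have := congrArg im h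
  simp at this
  exact hμ this

theorem exp_two_pi_I_mul_int (k : ℤ) : exp (2 * Real.pi * I * k) = 1 := by
  rw [mul_comm]; exact exp_int_mul_two_pi_mul_I k

/-- Injectivity of the passage from fibre points to subsets: both points come from solutions near z
of the same perturbed system. -/
theorem IsNear.unique (hτ : 0 < τ.im) (hh : IsClassOf h.1 (thetaProd τ (-μ) z))
    (hμ : μ.im ≠ 0) {s : Finset (Fin (2 * m))} (hr : 0 < r)
    (hu : ∃! u : Fin (2 * m) → ℂ, dist u z < r ∧ perturbedValues τ (signVector s) z
      (-(2 * Real.pi * I * (-(μ + k) - k))⁻¹, u) = 0)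
    {p q : PA τ m 1 × ↥(P τ m \ PA τ m 1)} (hp : wronskiMap τ m p = h)
    (hq : wronskiMap τ m q = h) (hpn : IsNear τ μ z r k s p) (hqn : IsNear τ μ z r k s q) :
    p = q := by
  obtain ⟨u, hu1, hu2, hu3⟩ := hpn
  obtain ⟨v, hv1, hv2, hv3⟩ := hqn
  obtain rfl := hu.unique
    ⟨(dist_pi_lt_iff hr).mpr hu1, perturbedValues_eq_zero hτ hh hp (ne_of_im_ne k hμ) hu2 hu3⟩
    ⟨(dist_pi_lt_iff hr).mpr hv1, perturbedValues_eq_zero hτ hh hq (ne_of_im_ne k hμ) hv2 hv3⟩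
  exact Prod.ext (Subtype.ext (hu2.eq hv2)) (Subtype.ext (hu3.eq hv3))

/-- A zero of f near z a must be a zero of its other representation, and disjointness of the balls
forces it to carry the same index. Applied in both directions, it makes the subset an invariant of
the point. -/
theorem IsNear.subset (hτ : 0 < τ.im) (hr : IsSmallRadius τ w z r) {s s' : Finset (Fin (2 * m))}
    {p : PA τ m 1 × ↥(P τ m \ PA τ m 1)} (h1 : IsNear τ μ z r k s p)
    (h2 : IsNear τ μ z r k s' p) : s ⊆ s' := by
  obtain ⟨u, hu1, hu2, -⟩ := h1
  obtain ⟨v, hv1, hv2, -⟩ := h2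
  obtain ⟨c, hc, hcu⟩ := hv2.exists_eq_smul hu2
  intro a ha
  have h0 : expThetaFinset τ k s' v (u a) = 0 := by
    rw [hcu, Pi.smul_apply, expThetaFinset, Pi.mul_apply, thetaFinset, Finset.prod_eq_zero ha
      (by rw [sub_self, theta_zero hτ]), mul_zero, smul_zero]
  rw [expThetaFinset, Pi.mul_apply, mul_eq_zero, or_iff_right (exp_ne_zero _), thetaFinset,
    Finset.prod_eq_zero_iff] at h0
  obtain ⟨b, hb, h0⟩ := h0
  by_cases hab : a = b
  · rwa [hab]
  · exact absurd h0 (hr.theta_sub_ne_zero hτ hu1 hv1 hab)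

theorem IsNear.exists_roots (hτ : 0 < τ.im) (hh : IsClassOf h.1 (thetaProd τ (-μ) z))
    (hr : IsSmallRadius τ w z r) (hμ : μ.im ≠ 0) {s : Finset (Fin (2 * m))} (hs : s.card = m)
    {p : PA τ m 1 × ↥(P τ m \ PA τ m 1)} (hp : wronskiMap τ m p = h)
    (hpn : IsNear τ μ z r k s p) :
    ∃ t t' : Fin m → ℂ, (∀ j, t j ∈ openParallelogram τ w) ∧
      (∀ j, t' j ∈ openParallelogram τ w) ∧ Function.Injective (Sum.elim (Sum.elim t t') z) ∧
      IsClassOf p.1.1 (thetaProd τ k t) ∧ IsClassOf p.2.1 (thetaProd τ (-(μ + k)) t') := by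
  obtain ⟨u, hu1, hu2, hu3⟩ := hpn
  have hs' : sᶜ.card = m := by rw [Finset.card_compl, hs, Fintype.card_fin]; omega
  obtain ⟨e, he⟩ := exists_embedding_of_card_eq hs
  obtain ⟨e', he'⟩ := exists_embedding_of_card_eq hs'
  have hval := perturbedValues_eq_zero hτ hh hp (ne_of_im_ne k hμ) hu2 hu3
  have hui : Function.Injective u := fun a b hab =>
    hr.eq_of_dist_lt (hu1 a) (by rw [hab]; exact hu1 b)
  -- Disjoint balls leave only the case u a = z a, where the perturbed product would have to vanish
  -- at its own point u a.
  have huz : ∀ a b, u a ≠ z b := by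
    intro a b hab
    have hab' : a = b := hr.eq_of_dist_lt (hu1 a) (by rw [hab, dist_self]; exact hr.pos)
    subst hab'
    have h1 := congrFun hval a
    simp only [perturbedValues, Pi.zero_apply, ← hab] at h1
    refine perturbedProd_apply_self_ne_zero hτ ?_ ?_
      (fun b hb => hr.theta_sub_ne_zero hτ hu1 hu1 hb) h1
    · exact neg_ne_zero.mpr (inv_ne_zero (mul_ne_zero two_pi_I_ne_zero
        (sub_ne_zero.mpr (ne_of_im_ne k hμ))))
    · unfold signVector; split_ifs <;> norm_num
  have hzi : Function.Injective z := by
    intro a b hab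
    exact hr.eq_of_dist_lt (x := z a) (by rw [dist_self]; exact hr.pos)
      (by rw [hab, dist_self]; exact hr.pos)
  refine ⟨u ∘ e, u ∘ e', fun j => hr.mem_openParallelogram _ _ (hu1 _),
    fun j => hr.mem_openParallelogram _ _ (hu1 _), ?_, ?_, ?_⟩
  · refine Function.Injective.sumElim (Function.Injective.sumElim (hui.comp e.injective)
      (hui.comp e'.injective) fun i j hij => ?_) hzi ?_
    · have h1 : e i ∈ s := by rw [← he]; exact Finset.mem_map_of_mem e (Finset.mem_univ i)
      have h2 : e' j ∈ sᶜ := by rw [← he']; exact Finset.mem_map_of_mem e' (Finset.mem_univ j)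
      rw [← hui hij, Finset.mem_compl] at h2
      exact h2 h1
    · rintro (j | j) b
      · exact huz _ _
      · exact huz _ _
  · rwa [← expThetaFinset_eq_thetaProd e he]
  · rwa [← expThetaFinset_eq_thetaProd e' he']

theorem exists_isNear_of_perturbedValues_eq_zero (hτ : 0 < τ.im) (hm : 0 < m)
    (hh : IsClassOf h.1 (thetaProd τ (-μ) z)) (hr : IsSmallRadius τ w z r) (hμ : μ.im ≠ 0)
    {s : Finset (Fin (2 * m))} (hs : s.card = m) {u : Fin (2 * m) → ℂ}
    (hu : ∀ a, dist (u a) (z a) < r)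
    (hval : perturbedValues τ (signVector s) z (-(2 * Real.pi * I * (-(μ + k) - k))⁻¹, u) = 0) :
    ∃ p ∈ labeledPreimage τ w m h k, IsNear τ μ z r k s p := by
  have hs' : sᶜ.card = m := by rw [Finset.card_compl, hs, Fintype.card_fin]; omega
  set f := expThetaFinset τ k s u with hf
  set g := expThetaFinset τ (-(μ + k)) sᶜ u with hg
  have hf0 : f ≠ 0 := expThetaFinset_ne_zero hτ _ _ _
  have hg0 : g ≠ 0 := expThetaFinset_ne_zero hτ _ _ _
  have hfT := expThetaFinset_mem_T hτ s k u
  have hgT := expThetaFinset_mem_T hτ sᶜ (-(μ + k)) u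
  rw [hs, exp_two_pi_I_mul_int, ← hf] at hfT
  rw [hs', ← hg] at hgT
  have hA : 1 ≠ exp (2 * Real.pi * I * (-(μ + k))) := by
    intro h1
    have h2 := exp_two_pi_I_mul_int 0
    rw [h1] at h2
    obtain ⟨n, hn⟩ := exists_int_of_exp_eq h2
    have := congrArg im hn
    simp at this
    exact hμ this
  have hp1 : Projectivization.mk ℂ f hf0 ∈ PA τ m 1 :=
    ⟨one_ne_zero, _, exp_ne_zero _, (isClassOf_mk hf0).submodule_le_iff.mpr hfT⟩
  have hp2 : Projectivization.mk ℂ g hg0 ∈ P τ m \ PA τ m 1 := by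
    refine ⟨Set.mem_iUnion.mpr ⟨_, exp_ne_zero _, _, exp_ne_zero _,
      (isClassOf_mk hg0).submodule_le_iff.mpr hgT⟩, ?_⟩
    rintro ⟨-, B, -, hB⟩
    exact hA (multiplier_unique ((isClassOf_mk hg0).submodule_le_iff.mp hB) hgT hg0)
  have hw0 : wr f g ≠ 0 := wr_ne_zero hfT hgT hf0 hg0 hA
  have hwT := wr_expThetaFinset_mem_T hτ hs k (-(μ + k)) u
  rw [← hf, ← hg] at hwT
  -- The Wronskian has degree 2m and vanishes at the 2m inequivalent points z a, so only its
  -- exponent remains to be identified.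
  obtain ⟨c, ν, hc⟩ := exists_eq_expThetaFinset hτ Finset.univ z
    (fun a _ b _ hab => hr.theta_sub_ne_zero hτ
      (fun a => by rw [dist_self]; exact hr.pos) (fun a => by rw [dist_self]; exact hr.pos) hab)
    (exp_ne_zero _) (exp_ne_zero _)
    (by rw [Finset.card_univ, Fintype.card_fin]; exact hwT)
    (fun a _ => (wr_apply_eq_zero_iff hτ s u (ne_of_im_ne k hμ) (z a)).mpr (congrFun hval a))
  have hc0 : c ≠ 0 := by
    rintro rfl
    exact hw0 (by rw [hc, zero_smul])
  have hν : (k : ℂ) + -(μ + k) = ν := by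
    refine exponent_unique hτ hwT ?_ hw0 (hr.abs_im_sum_sub_lt hm hu)
    rw [hc]
    exact Submodule.smul_mem _ _ (thetaProd_mem_T hτ ν z)
  have hν' : ν = -μ := by rw [← hν]; ring
  refine ⟨(⟨_, hp1⟩, ⟨_, hp2⟩), ⟨Subtype.ext ?_, ?_⟩, u, hu, isClassOf_mk hf0, isClassOf_mk hg0⟩
  · have h1 := wronskiMap_isClassOf τ m (⟨_, hp1⟩, ⟨_, hp2⟩) (isClassOf_mk hf0) (isClassOf_mk hg0)
    rw [hc, hν'] at h1
    exact (h1.of_smul hc0).eq hh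
  · obtain ⟨e, he⟩ := exists_embedding_of_card_eq hs
    refine ⟨u ∘ e, fun j => openParallelogram_subset _ _ (hr.mem_openParallelogram _ _ (hu _)), ?_⟩
    rw [← expThetaFinset_eq_thetaProd e he]
    exact isClassOf_mk hf0

/-- Every fibre point arises from a subset. The exponent ν of g is not known in advance, so `hperm`
covers all ν with the right imaginary part of ν - k. -/
theorem exists_isNear_of_mem_labeledPreimage (hτ : 0 < τ.im) (hm : 0 < m)
    (hh : IsClassOf h.1 (thetaProd τ (-μ) z)) (hr : IsSmallRadius τ w z r) (hμ : μ.im ≠ 0)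
    (hperm : ∀ ν : ℂ, |(ν - k).im| = |μ.im| → ∀ (s : Finset (Fin (2 * m))) (u : Fin (2 * m) → ℂ),
      (∀ a, u a ∈ closedParallelogram τ w) →
      perturbedValues τ (signVector s) z (-(2 * Real.pi * I * (ν - k))⁻¹, u) = 0 →
      ∃ σ : Equiv.Perm (Fin (2 * m)), ∀ a, dist (u a) (z (σ a)) < r)
    {p : PA τ m 1 × ↥(P τ m \ PA τ m 1)} (hp : p ∈ labeledPreimage τ w m h k) :
    ∃ s : Finset (Fin (2 * m)), s.card = m ∧ IsNear τ μ z r k s p := by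
  obtain ⟨hp, t, htΛ, ht⟩ := hp
  obtain ⟨c, ν, t', hc, htΛ', hg⟩ : ∃ (c ν : ℂ) (t' : Fin m → ℂ), c ≠ 0 ∧
      (∀ j, t' j ∈ parallelogram τ w) ∧ p.2.1.rep = c • thetaProd τ ν t' := by
    obtain ⟨A, hA, B, hB, hT⟩ := Set.mem_iUnion.mp p.2.2.1
    exact exists_eq_thetaProd hτ w hA hB (rep_mem hT) p.2.1.rep_nonzero
  have ht' : IsClassOf p.2.1 (thetaProd τ ν t') :=
    IsClassOf.of_smul hc (by rw [← hg]; exact isClassOf_rep _)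
  have hrep : ∀ e : Fin m ⊕ Fin m ≃ Fin (2 * m), ∃ s : Finset (Fin (2 * m)), s.card = m ∧
      IsClassOf p.1.1 (expThetaFinset τ k s (Sum.elim t t' ∘ e.symm)) ∧
      IsClassOf p.2.1 (expThetaFinset τ ν sᶜ (Sum.elim t t' ∘ e.symm)) := by
    intro e
    obtain ⟨s, i, i', hi, hi', hie, hie'⟩ := exists_split_embeddings e
    refine ⟨s, by rw [← hi, Finset.card_map, Finset.card_univ, Fintype.card_fin], ?_, ?_⟩
    · rw [expThetaFinset_eq_thetaProd i hi]
      convert ht using 2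
      funext j
      simp [hie]
    · rw [expThetaFinset_eq_thetaProd i' hi']
      convert ht' using 2
      funext j
      simp [hie']
  have hwr : ∀ {s : Finset (Fin (2 * m))} {u : Fin (2 * m) → ℂ}, s.card = m →
      IsClassOf p.1.1 (expThetaFinset τ k s u) → IsClassOf p.2.1 (expThetaFinset τ ν sᶜ u) →
      thetaProd τ (-μ) z ∈ T τ (2 * m) (exp (2 * Real.pi * I * (k + ν)))
        (exp (2 * Real.pi * I * ((k + ν) * τ + ∑ a, u a))) := by
    intro s u hs h1 h2
    obtain ⟨c, hc, hw⟩ := exists_wr_eq_smul hh hp h1 h2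
    have h3 := wr_expThetaFinset_mem_T hτ hs k ν u
    rwa [hw, Submodule.smul_mem_iff _ hc] at h3
  let e : Fin m ⊕ Fin m ≃ Fin (2 * m) := finSumFinEquiv.trans (finCongr (two_mul m).symm)
  obtain ⟨s, hs, h1, h2⟩ := hrep e
  -- The first multiplier gives k + ν = -μ only up to an integer. This already fixes |Im(ν - k)|,
  -- hence the smallness of ε; once the zeros are known to be near z, the integer is shown to be 0.
  obtain ⟨n, hn⟩ := exists_int_of_exp_eq
    (multiplier_unique (hwr hs h1 h2) (thetaProd_mem_T hτ (-μ) z) (thetaProd_ne_zero hτ (-μ) z))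
  have him : |(ν - k).im| = |μ.im| := by
    have h3 : ν - k = -μ + n - 2 * k := by linear_combination hn
    rw [h3]
    simp
  have hνk : ν ≠ k := by
    rintro rfl
    rw [sub_self, zero_im, abs_zero, eq_comm, abs_eq_zero] at him
    exact hμ him
  obtain ⟨σ, hσ⟩ := hperm ν him s (Sum.elim t t' ∘ e.symm) (fun a => by
    rw [Function.comp_apply]
    rcases e.symm a with j | j
    · exact parallelogram_subset_closed _ _ (htΛ j)
    · exact parallelogram_subset_closed _ _ (htΛ' j))
    (perturbedValues_eq_zero hτ hh hp hνk h1 h2)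
  have hu : ∀ a, dist ((Sum.elim t t' ∘ (e.trans σ).symm) a) (z a) < r := by
    intro a
    have := hσ (σ.symm a)
    rwa [σ.apply_symm_apply] at this
  -- Renumbering the zeros by σ puts the a-th one near z a and replaces s by the corresponding
  -- subset.
  obtain ⟨s', hs', h1', h2'⟩ := hrep (e.trans σ)
  have hν : (k : ℂ) + ν = -μ := exponent_unique hτ (hwr hs' h1' h2') (thetaProd_mem_T hτ (-μ) z)
    (thetaProd_ne_zero hτ (-μ) z) (hr.abs_im_sum_sub_lt hm hu)
  refine ⟨s', hs', _, hu, h1', ?_⟩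
  rwa [show -(μ + (k : ℂ)) = ν by linear_combination -hν]

end count

end EllipticWronski

end

/-! ### Choice of constants and the final count. -/

theorem mainTheorem4 (τ : ℂ) (hτ : 0 < τ.im) (m : ℕ) (hm : 0 < m) (w : ℂ)
    (z : Fin (2 * m) → ℂ) (hz : ∀ a, z a ∈ EllipticWronski.openParallelogram τ w)
    (hzd : Function.Injective z) :
    ∃ N : ℝ, 0 < N ∧
      ∀ (h : ↥(EllipticWronski.P τ (2 * m) \ EllipticWronski.PA τ (2 * m) 1)) (μ : ℂ),
        EllipticWronski.IsClassOf h.1 (EllipticWronski.thetaProd τ (-μ) z) →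
        N < |μ.im| →
        ∀ k : ℤ,
          (EllipticWronski.labeledPreimage τ w m h k).encard = (Nat.choose (2 * m) m : ℕ∞) ∧
          ∀ p ∈ EllipticWronski.labeledPreimage τ w m h k,
            ∃ t s : Fin m → ℂ,
              (∀ j, t j ∈ EllipticWronski.openParallelogram τ w) ∧
              (∀ j, s j ∈ EllipticWronski.openParallelogram τ w) ∧
              Function.Injective (Sum.elim (Sum.elim t s) z) ∧
              EllipticWronski.IsClassOf p.1.1 (EllipticWronski.thetaProd τ k t) ∧
              EllipticWronski.IsClassOf p.2.1 (EllipticWronski.thetaProd τ (-(μ + k)) s) := by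
  open EllipticWronski Filter Topology Complex in
  obtain ⟨r, hr, hex⟩ := ((eventually_isSmallRadius hτ hz hzd).and
    (eventually_all.mpr fun s : Finset (Fin (2 * m)) =>
      exists_unique_perturbed_zero hτ (signVector s) z fun a b hab =>
        theta_sub_ne_zero hτ (hz a) (hz b) (hzd.ne hab))).exists
  -- There are finitely many sign vectors, so one δ serves all subsets s.
  obtain ⟨δ, hδ, hε⟩ := Metric.eventually_nhds_iff.mp ((eventually_all.mpr hex).and
    (eventually_all.mpr fun s : Finset (Fin (2 * m)) =>
      exists_perm_of_perturbed_zero hτ (signVector s) z hz hzd hr.pos))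
  -- Since |ε| = 1/(2π|ν - k|) and |ν - k| ≥ |Im μ|, the bound 1/δ is more than enough for |ε| < δ,
  -- whatever k is.
  refine ⟨1 / δ, by positivity, fun h μ hh hN k => ?_⟩
  have hN0 : 0 < |μ.im| := lt_trans (by positivity) hN
  have hμ : μ.im ≠ 0 := abs_pos.mp hN0
  have hsmall : ∀ ν : ℂ, |(ν - k).im| = |μ.im| → dist (-(2 * Real.pi * I * (ν - k))⁻¹) 0 < δ := by
    intro ν hν
    rw [dist_zero_right, norm_neg, norm_inv, norm_mul, norm_mul, norm_mul, norm_I, mul_one,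
      Complex.norm_ofNat, norm_real, Real.norm_of_nonneg Real.pi_pos.le]
    have h1 : 1 / δ < ‖ν - k‖ := by
      calc 1 / δ < |(ν - k).im| := by rw [hν]; exact hN
        _ ≤ ‖ν - k‖ := abs_im_le_norm _
    have h2 : 1 / δ < 2 * Real.pi * ‖ν - k‖ := by
      nlinarith [Real.pi_gt_three, norm_nonneg (ν - k)]
    exact inv_lt_of_inv_lt₀ hδ (by rwa [one_div] at h2)
  have hbase : |(-(μ + k) - k : ℂ).im| = |μ.im| := by simp
  have hnear : ∀ p ∈ labeledPreimage τ w m h k, ∃ s : Finset (Fin (2 * m)), s.card = m ∧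
      IsNear τ μ z r k s p := fun p hp =>
    exists_isNear_of_mem_labeledPreimage hτ hm hh hr hμ
      (fun ν hν s => (hε (hsmall ν hν)).2 s) hp
  have hsol : ∀ s : Finset (Fin (2 * m)), s.card = m →
      ∃ p ∈ labeledPreimage τ w m h k, IsNear τ μ z r k s p := by
    intro s hs
    obtain ⟨u, ⟨hu1, hu2⟩, -⟩ := (hε (hsmall _ hbase)).1 s
    exact exists_isNear_of_perturbedValues_eq_zero hτ hm hh hr hμ hs
      ((dist_pi_lt_iff hr.pos).mp hu1) hu2
  refine ⟨?_, fun p hp => ?_⟩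
  · have hsol' : ∀ s : Finset (Fin (2 * m)), ∃ p, s.card = m →
        p ∈ labeledPreimage τ w m h k ∧ IsNear τ μ z r k s p := by
      intro s
      by_cases hs : s.card = m
      · obtain ⟨p, hp⟩ := hsol s hs
        exact ⟨p, fun _ => hp⟩
      -- For subsets of the wrong size any value will do; a point attached to some m-subset serves
      -- as the default that makes `F` total.
      · obtain ⟨s₀, -, hs₀⟩ := Finset.exists_subset_card_eq
          (s := (Finset.univ : Finset (Fin (2 * m)))) (n := m)
          (by rw [Finset.card_univ, Fintype.card_fin]; omega)
        obtain ⟨p, -⟩ := hsol s₀ hs₀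
        exact ⟨p, fun h => absurd h hs⟩
    choose F hF using hsol'
    have himage : labeledPreimage τ w m h k =
        F '' (Finset.powersetCard m (Finset.univ : Finset (Fin (2 * m))) : Set _) := by
      ext p
      constructor
      · intro hp
        obtain ⟨s, hs, hsp⟩ := hnear p hp
        refine ⟨s, by simpa using hs, ?_⟩
        exact IsNear.unique hτ hh hμ hr.pos ((hε (hsmall _ hbase)).1 s) (hF s hs).1.1 hp.1
          (hF s hs).2 hsp
      · rintro ⟨s, hs, rfl⟩
        exact (hF s (by simpa using hs)).1
    have hinj : Set.InjOn F
        (Finset.powersetCard m (Finset.univ : Finset (Fin (2 * m))) : Set _) := by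
      intro s hs s' hs' hss
      have h1 := (hF s (by simpa using hs)).2
      have h2 := (hF s' (by simpa using hs')).2
      rw [hss] at h1
      exact (h1.subset hτ hr h2).antisymm (h2.subset hτ hr h1)
    rw [himage, hinj.encard_image, Set.encard_coe_eq_coe_finsetCard, Finset.card_powersetCard,
      Finset.card_univ, Fintype.card_fin]
  · obtain ⟨s, hs, hsp⟩ := hnear p hp
    exact hsp.exists_roots hτ hh hr hμ hs hp.1
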